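/- Let $m,n\ge 0$ be integers, $N=mn$, $\mathfrak h^*=\mathbb C^N$ with standard basis $\omega(1),\dots,\omega(N)$, and let $M_{\mathfrak h^*}$ be the field of meromorphic functions $f(\underline\lambda)=f(\lambda_1,\dots,\lambda_N)$ on $\mathfrak h^*$. Let $q\in\mathbb C^\times$ be not a root of unity, fix a logarithm of $q$ and let $q^z$ be the corresponding power. Put $$h(z)=q\,\frac{q^{-2z}-q^{-2}}{q^{-2z}-1},\qquad g(z)=h(z)h(-z).$$ **The algebra $\mathscr F_R(M(N))$.** It is the associative unital $\mathbb C$-algebra generated by $t_{ij}$ ($1\le i,j\le N$) and two copies of $M_{\mathfrak h^*}$, with elements $\mu_l(f)=f(\underline\lambda)$ and $\mu_r(f)=f(\underline\mu)$, subject to $f_1(\underline\lambda)f_2(\underline\mu)=f_2(\underline\mu)f_1(\underline\lambda)$, $f(\underline\lambda)t_{ij}=t_{ij}f(\underline\lambda+\omega(i))$, $f(\underline\mu)t_{ij}=t_{ij}f(\underline\mu+\omega(j))$ and the dynamical RTT relations $$\begin{aligned} h(\mu_k-\mu_l)t_{ik}t_{il}&=t_{il}t_{ik} &&(k<l),\\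 h(\lambda_j-\lambda_i)t_{jk}t_{ik}&=t_{ik}t_{jk} &&(i<j),\\ t_{ik}t_{jl}&=t_{jl}t_{ik}+\bigl(h(\lambda_j-\lambda_i)-h(\mu_k-\mu_l)\bigr)t_{jk}t_{il} &&(i<j,\ k<l),\\ g(\mu_k-\mu_l)t_{ik}t_{jl}&=g(\lambda_i-\lambda_j)t_{jl}t_{ik}+\bigl(h(\mu_l-\mu_k)-h(\lambda_i-\lambda_j)\bigr)t_{il}t_{jk} &&(i<j,\ k<l),\\ t_{il}t_{jk}&=g(\lambda_i-\lambda_j)t_{jk}t_{il}+\bigl(h(\mu_k-\mu_l)-h(\lambda_i-\lambda_j)\bigr)t_{ik}t_{jl} &&(i<j,\ k<l). \end{aligned}$$ It is bigraded by $\deg t_{ij}=(\omega(i),\omega(j))$, $\deg f(\underline\lambda)=\deg f(\underline\mu)=(0,0)$; its components are denoted $\mathscr F_{\alpha\beta}$. **Signs and minors.** For $I=\{i_1<\dots<i_r\}\subseteq[1,N]$ and $\sigma\in S_r$ put $$S(\sigma,I)=\prod_{k<l,\ \sigma(k)>\sigma(l)}\bigl(-h(\lambda_{i_{\sigma(k)}}-\lambda_{i_{\sigma(l)}})\bigr),\qquad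 \widetilde S(\sigma,I)=\prod_{k<l,\ \sigma(k)>\sigma(l)}\bigl(-h(\lambda_{i_{\sigma(l)}}-\lambda_{i_{\sigma(k)}})\bigr),$$ and $\widetilde S(\sigma)=\widetilde S(\sigma,[1,N])$ for $\sigma\in S_N$. For $|I|=|J|=r$ the dynamical quantum minor is $$\xi^I_J=\mu_r(S(\rho,J)^{-1})\sum_{\sigma\in S_r}\mu_l(S(\sigma,I))\,t_{i_{\sigma(1)}j_{\rho(1)}}\cdots t_{i_{\sigma(r)}j_{\rho(r)}},$$ where $\rho\in S_r$ is arbitrary, and $\det(T)=\xi^{[1,N]}_{[1,N]}$. (The statement holds for every choice of $\rho$ in every minor that occurs and in $\det(T)$.) **The algebra $\widetilde{\mathcal B}$.** It is the associative unital $\mathbb C$-algebra generated by elements $\widetilde b_I=\widetilde b_{i_m\cdots i_1}$, one for each $I=\{i_1<\dots<i_m\}\subseteq[1,N]$, and a copy of $M_{\mathfrak h^*}$, subject only to $f(\underline\lambda)\,\widetilde b_I=\widetilde b_I\,f(\underline\lambda+\omega(I))$ with $\omega(I)=\sum_{i\in I}\omega(i)$. It is graded by $\deg\widetilde b_I=\omega(I)$,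 $\deg f=0$; its components are denoted $\widetilde{\mathcal B}_\alpha$. **The tensor product.** $\widetilde{\mathcal B}\,\widetilde\otimes\,\mathscr F_R(M(N))$ is the quotient of $\bigoplus_{\alpha,\beta}\widetilde{\mathcal B}_\alpha\otimes_{\mathbb C}\mathscr F_{\alpha\beta}$ by the relations $fb\otimes t=b\otimes\mu_l(f)t$; it is an algebra with $(b\otimes t)(b'\otimes t')=bb'\otimes tt'$, and $M_{\mathfrak h^*}$ acts on it by $f(b\otimes t)=b\otimes\mu_r(f)t$. **Hyper-Pfaffian.** Let $\Pi$ be the set of $\sigma\in S_{mn}$ with $\sigma((k-1)m+1)<\dots<\sigma(km)$ for $k=1,\dots,n$. For a family $X=(x_I)_{|I|=m}$, $x_I=x_{i_m\cdots i_1}$, in an algebra on which $M_{\mathfrak h^*}$ acts, put $$\widetilde{\mathrm{Pf}}_m(X)=\sum_{\sigma\in\Pi}\widetilde S(\sigma)\,x_{\sigma(mn)\cdots\sigma(mn-m+1)}\,x_{\sigma(mn-m)\cdots\sigma(mn-2m+1)}\cdots x_{\sigma(m)\cdots\sigma(1)}.$$ Here $M_{\mathfrak h^*}$ acts on $\widetilde{\mathcal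 B}$ by left multiplication, and on $\widetilde{\mathcal B}\,\widetilde\otimes\,\mathscr F_R(M(N))$ as above. **Theorem.** Let $\widetilde B=(\widetilde b_I)_I$ and $C=(c_I)_I$ with $c_I=\sum_{J}\widetilde b_J\otimes\xi^J_I$, the sum being over all $J\subseteq[1,mn]$ with $|J|=m$. Then in $\widetilde{\mathcal B}\,\widetilde\otimes\,\mathscr F_R(M(mn))$ $$\widetilde{\mathrm{Pf}}_m(C)=\widetilde{\mathrm{Pf}}_m(\widetilde B)\otimes\det(T).$$ -/

import Mathlib

noncomputable section

open scoped TensorProduct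

namespace DynPfaffian

/-! ### Meromorphic functions on `𝔥* = ℂ^N` -/

/-- The ring of entire functions on `ℂ^N`. -/
def Entire (N : ℕ) : Subalgebra ℂ ((Fin N → ℂ) → ℂ) where
  carrier := {f | AnalyticOnNhd ℂ f Set.univ}
  mul_mem' hf hg := hf.mul hg
  add_mem' hf hg := hf.add hg
  algebraMap_mem' _ := analyticOnNhd_const

instance (N : ℕ) : IsDomain (Entire N) := by
  have : NoZeroDivisors (Entire N) := by
    refine ⟨?_⟩
    rintro ⟨f, hf⟩ ⟨g, hg⟩ h
    by_cases hf0 : f = 0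
    · left; exact Subtype.ext hf0
    · right
      obtain ⟨x, hx⟩ := Function.ne_iff.mp hf0
      have hfg : ∀ y, f y * g y = 0 := fun y => congrFun (congrArg Subtype.val h) y
      have hev : ∀ᶠ y in nhds x, f y ≠ 0 :=
        (hf x (Set.mem_univ x)).continuousAt.eventually_ne hx
      have hg0 : g =ᶠ[nhds x] 0 := by
        filter_upwards [hev] with y hy
        exact (mul_eq_zero.mp (hfg y)).resolve_left hy
      have hz : AnalyticOnNhd ℂ (0 : (Fin N → ℂ) → ℂ) Set.univ := analyticOnNhd_const
      exact Subtype.ext (AnalyticOnNhd.eq_of_eventuallyEq hg hz hg0)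
  exact NoZeroDivisors.to_isDomain _

/-- The field `M_{𝔥*}` of meromorphic functions on `ℂ^N`, i.e. of quotients of entire functions
(on `ℂ^N` every meromorphic function is a global quotient of two entire functions). -/
abbrev Mero (N : ℕ) : Type := FractionRing (Entire N)

/-- `λ ↦ λ + α`, acting on entire functions: `(T_α f)(λ) = f(λ + α)`. -/
def shiftEntire {N : ℕ} (α : Fin N → ℂ) : Entire N →+* Entire N where
  toFun f := ⟨fun x => f.1 (x + α), fun x _ =>
    (f.2 (x + α) (Set.mem_univ _)).comp_of_eq (analyticAt_id.add analyticAt_const) rfl⟩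
  map_one' := rfl
  map_mul' _ _ := rfl
  map_zero' := rfl
  map_add' _ _ := rfl

theorem shiftEntire_injective {N : ℕ} (α : Fin N → ℂ) :
    Function.Injective (shiftEntire α) := by
  intro f g h
  refine Subtype.ext (funext fun x => ?_)
  have := congrFun (congrArg Subtype.val h) (x - α)
  simpa [shiftEntire] using this

/-- `T_α : M_{𝔥*} → M_{𝔥*}`, `(T_α f)(λ) = f(λ + α)`. -/
def shift {N : ℕ} (α : Fin N → ℂ) : Mero N →+* Mero N :=
  IsFractionRing.map (shiftEntire_injective α)

/-- The basis vectors `ω(i) = e_i` of `𝔥*`. -/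
def wt {N : ℕ} (i : Fin N) : Fin N → ℂ := Pi.single i 1

/-- The entire function `λ ↦ q^{-2(λ_i - λ_j)}`, where `q^z = exp (ℓ z)`. -/
def qpow (ℓ : ℂ) {N : ℕ} (i j : Fin N) : Entire N :=
  ⟨fun x => Complex.exp (ℓ * (-2 * (x i - x j))), fun x _ => by
    have hi : ∀ k : Fin N, AnalyticAt ℂ (fun y : Fin N → ℂ => y k) x := fun k =>
      (ContinuousLinearMap.proj (R := ℂ) (φ := fun _ : Fin N => ℂ) k).analyticAt x
    exact (analyticAt_const.mul (analyticAt_const.mul ((hi i).sub (hi j)))).cexp⟩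

/-- The meromorphic function `h(λ_i - λ_j)`, where
`h(z) = q (q^{-2z} - q^{-2}) / (q^{-2z} - 1)`, `q = exp ℓ` and `q^z = exp (ℓ z)`. -/
def hfun (ℓ : ℂ) {N : ℕ} (i j : Fin N) : Mero N :=
  algebraMap ℂ (Mero N) (Complex.exp ℓ) *
    ((algebraMap (Entire N) (Mero N) (qpow ℓ i j)
        - algebraMap ℂ (Mero N) ((Complex.exp ℓ)⁻¹ ^ 2)) /
      (algebraMap (Entire N) (Mero N) (qpow ℓ i j) - 1))

/-- `g(λ_i - λ_j)`, where `g(z) = h(z) h(-z)`. -/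
def gfun (ℓ : ℂ) {N : ℕ} (i j : Fin N) : Mero N := hfun ℓ i j * hfun ℓ j i

/-! ### Generalized signs -/

/-- `S(σ, I) = ∏_{k < l, σ(k) > σ(l)} (-h(λ_{i_σ(k)} - λ_{i_σ(l)}))`, `I = {i_1 < ⋯ < i_r}`. -/
def genSign (ℓ : ℂ) {N r : ℕ} (σ : Equiv.Perm (Fin r)) (I : Fin r ↪o Fin N) : Mero N :=
  ∏ p : Fin r × Fin r with p.1 < p.2 ∧ σ p.2 < σ p.1, -hfun ℓ (I (σ p.1)) (I (σ p.2))

/-- `S̃(σ, I) = ∏_{k < l, σ(k) > σ(l)} (-h(λ_{i_σ(l)} - λ_{i_σ(k)}))`, `I = {i_1 < ⋯ < i_r}`. -/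
def genSignTilde (ℓ : ℂ) {N r : ℕ} (σ : Equiv.Perm (Fin r)) (I : Fin r ↪o Fin N) : Mero N :=
  ∏ p : Fin r × Fin r with p.1 < p.2 ∧ σ p.2 < σ p.1, -hfun ℓ (I (σ p.2)) (I (σ p.1))

/-! ### The dynamical quantum matrix algebra `F_R(M(N))` -/

/-- Generators of `F_R(M(N))`: the `t_{ij}` and two copies `f(λ)`, `f(μ)` of `M_{𝔥*}`. -/
inductive MatGen (N : ℕ) : Type
  | t (i j : Fin N) : MatGen N
  | lam (f : Mero N) : MatGen N
  | mu (f : Mero N) : MatGen N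

namespace MatFree

/-- `t_{ij}` in the free algebra. -/
abbrev t {N : ℕ} (i j : Fin N) : FreeAlgebra ℂ (MatGen N) := FreeAlgebra.ι ℂ (MatGen.t i j)
/-- `f(λ)` in the free algebra. -/
abbrev lam {N : ℕ} (f : Mero N) : FreeAlgebra ℂ (MatGen N) := FreeAlgebra.ι ℂ (MatGen.lam f)
/-- `f(μ)` in the free algebra. -/
abbrev mu {N : ℕ} (f : Mero N) : FreeAlgebra ℂ (MatGen N) := FreeAlgebra.ι ℂ (MatGen.mu f)

end MatFree

open MatFree in
/-- Defining relations of `F_R(M(N))`. The first six say that `f ↦ f(λ)` and `f ↦ f(μ)` are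
algebra homomorphisms. The last five are the dynamical `RTT` relations. -/
inductive MatRel (ℓ : ℂ) (N : ℕ) :
    FreeAlgebra ℂ (MatGen N) → FreeAlgebra ℂ (MatGen N) → Prop
  | lam_add (f g : Mero N) : MatRel ℓ N (lam (f + g)) (lam f + lam g)
  | lam_mul (f g : Mero N) : MatRel ℓ N (lam (f * g)) (lam f * lam g)
  | lam_const (c : ℂ) : MatRel ℓ N (lam (algebraMap ℂ (Mero N) c)) (algebraMap ℂ _ c)
  | mu_add (f g : Mero N) : MatRel ℓ N (mu (f + g)) (mu f + mu g)
  | mu_mul (f g : Mero N) : MatRel ℓ N (mu (f * g)) (mu f * mu g)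
  | mu_const (c : ℂ) : MatRel ℓ N (mu (algebraMap ℂ (Mero N) c)) (algebraMap ℂ _ c)
  | lam_mu (f g : Mero N) : MatRel ℓ N (lam f * mu g) (mu g * lam f)
  | lam_t (f : Mero N) (i j : Fin N) :
      MatRel ℓ N (lam f * t i j) (t i j * lam (shift (wt i) f))
  | mu_t (f : Mero N) (i j : Fin N) :
      MatRel ℓ N (mu f * t i j) (t i j * mu (shift (wt j) f))
  | row (i k l : Fin N) (hkl : k < l) :
      MatRel ℓ N (mu (hfun ℓ k l) * t i k * t i l) (t i l * t i k)
  | col (i j k : Fin N) (hij : i < j) :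
      MatRel ℓ N (lam (hfun ℓ j i) * t j k * t i k) (t i k * t j k)
  | diag (i j k l : Fin N) (hij : i < j) (hkl : k < l) :
      MatRel ℓ N (t i k * t j l)
        (t j l * t i k + (lam (hfun ℓ j i) - mu (hfun ℓ k l)) * t j k * t i l)
  | diag' (i j k l : Fin N) (hij : i < j) (hkl : k < l) :
      MatRel ℓ N (mu (gfun ℓ k l) * t i k * t j l)
        (lam (gfun ℓ i j) * t j l * t i k
          + (mu (hfun ℓ l k) - lam (hfun ℓ i j)) * t i l * t j k)
  | cross (i j k l : Fin N) (hij : i < j) (hkl : k < l) :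
      MatRel ℓ N (t i l * t j k)
        (lam (gfun ℓ i j) * t j k * t i l
          + (mu (hfun ℓ k l) - lam (hfun ℓ i j)) * t i k * t j l)

/-- The algebra `F_R(M(N))`. -/
def MatAlg (ℓ : ℂ) (N : ℕ) : Type := RingQuot (MatRel ℓ N)

instance (ℓ : ℂ) (N : ℕ) : Ring (MatAlg ℓ N) := inferInstanceAs (Ring (RingQuot (MatRel ℓ N)))
instance (ℓ : ℂ) (N : ℕ) : Algebra ℂ (MatAlg ℓ N) :=
  inferInstanceAs (Algebra ℂ (RingQuot (MatRel ℓ N)))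

/-- The image of a generator in `F_R(M(N))`. -/
def MatAlg.gen (ℓ : ℂ) {N : ℕ} (x : MatGen N) : MatAlg ℓ N :=
  RingQuot.mkAlgHom ℂ (MatRel ℓ N) (FreeAlgebra.ι ℂ x)

/-- The generator `t_{ij}`. -/
def tgen (ℓ : ℂ) {N : ℕ} (i j : Fin N) : MatAlg ℓ N := MatAlg.gen ℓ (MatGen.t i j)
/-- The left moment map `μ_l(f) = f(λ)`. -/
def muL (ℓ : ℂ) {N : ℕ} (f : Mero N) : MatAlg ℓ N := MatAlg.gen ℓ (MatGen.lam f)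
/-- The right moment map `μ_r(f) = f(μ)`. -/
def muR (ℓ : ℂ) {N : ℕ} (f : Mero N) : MatAlg ℓ N := MatAlg.gen ℓ (MatGen.mu f)

/-- The dynamical quantum minor
`ξ^I_J = μ_r(S(ρ,J)⁻¹) ∑_σ μ_l(S(σ,I)) t_{i_σ(1) j_ρ(1)} ⋯ t_{i_σ(r) j_ρ(r)}`, written with the
auxiliary permutation `ρ`. -/
def minor (ℓ : ℂ) {N r : ℕ} (ρ : Equiv.Perm (Fin r)) (I J : Fin r ↪o Fin N) : MatAlg ℓ N :=
  muR ℓ (genSign ℓ ρ J)⁻¹ * ∑ σ : Equiv.Perm (Fin r),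
    muL ℓ (genSign ℓ σ I) * (List.ofFn fun k : Fin r => tgen ℓ (I (σ k)) (J (ρ k))).prod

/-- The dynamical quantum determinant `det(T) = ξ^{[1,N]}_{[1,N]}`. -/
def det (ℓ : ℂ) {N : ℕ} (ρ : Equiv.Perm (Fin N)) : MatAlg ℓ N :=
  minor ℓ ρ (RelEmbedding.refl _) (RelEmbedding.refl _)

/-! ### The algebra `B̃` -/

/-- Generators of `B̃`: elements `b̃_I = b̃_{i_m ⋯ i_1}` for `I = {i_1 < ⋯ < i_m}`, and a copy of
`M_{𝔥*}`. -/
inductive PfGen (N m : ℕ) : Type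
  | b (I : Fin m ↪o Fin N) : PfGen N m
  | scal (f : Mero N) : PfGen N m

/-- `ω(I) = ∑_{i ∈ I} ω(i)`. -/
def wtSet {N m : ℕ} (I : Fin m ↪o Fin N) : Fin N → ℂ := ∑ k, wt (I k)

/-- Defining relations of `B̃`: `M_{𝔥*}` is mapped in by an algebra homomorphism, and `b̃_I` has
weight `ω(I)`, i.e. `f(λ) b̃_I = b̃_I f(λ + ω(I))`. No relation is imposed among the `b̃_I`. -/
inductive PfRel (N m : ℕ) : FreeAlgebra ℂ (PfGen N m) → FreeAlgebra ℂ (PfGen N m) → Prop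
  | scal_add (f g : Mero N) : PfRel N m (FreeAlgebra.ι ℂ (PfGen.scal (f + g)))
      (FreeAlgebra.ι ℂ (PfGen.scal f) + FreeAlgebra.ι ℂ (PfGen.scal g))
  | scal_mul (f g : Mero N) : PfRel N m (FreeAlgebra.ι ℂ (PfGen.scal (f * g)))
      (FreeAlgebra.ι ℂ (PfGen.scal f) * FreeAlgebra.ι ℂ (PfGen.scal g))
  | scal_const (c : ℂ) : PfRel N m
      (FreeAlgebra.ι ℂ (PfGen.scal (algebraMap ℂ (Mero N) c))) (algebraMap ℂ _ c)
  | scal_b (f : Mero N) (I : Fin m ↪o Fin N) : PfRel N m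
      (FreeAlgebra.ι ℂ (PfGen.scal f) * FreeAlgebra.ι ℂ (PfGen.b I))
      (FreeAlgebra.ι ℂ (PfGen.b I) * FreeAlgebra.ι ℂ (PfGen.scal (shift (wtSet I) f)))

/-- The algebra `B̃`. -/
def PfAlg (N m : ℕ) : Type := RingQuot (PfRel N m)

instance (N m : ℕ) : Ring (PfAlg N m) := inferInstanceAs (Ring (RingQuot (PfRel N m)))
instance (N m : ℕ) : Algebra ℂ (PfAlg N m) :=
  inferInstanceAs (Algebra ℂ (RingQuot (PfRel N m)))

/-- The image of a generator in `B̃`. -/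
def PfAlg.gen {N m : ℕ} (x : PfGen N m) : PfAlg N m :=
  RingQuot.mkAlgHom ℂ (PfRel N m) (FreeAlgebra.ι ℂ x)

/-- The generator `b̃_I`. -/
def bgen {N m : ℕ} (I : Fin m ↪o Fin N) : PfAlg N m := PfAlg.gen (PfGen.b I)
/-- The copy of `M_{𝔥*}` in `B̃`. -/
def scal {N m : ℕ} (f : Mero N) : PfAlg N m := PfAlg.gen (PfGen.scal f)

/-! ### Hyper-Pfaffians -/

/-- The permutations `σ` of `[1, nm]` that are increasing on each of the `n` consecutive blocks
of length `m`: `σ((k-1)m+1) < ⋯ < σ(km)`. -/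
def BlockPerm (n m : ℕ) : Type :=
  {σ : Equiv.Perm (Fin (n * m)) // ∀ k : Fin n, StrictMono fun a : Fin m =>
    σ (finProdFinEquiv (k, a))}

instance (n m : ℕ) : Fintype (BlockPerm n m) := by
  classical exact inferInstanceAs (Fintype {σ : Equiv.Perm (Fin (n * m)) // _})

/-- The set `{σ((k-1)m+1) < ⋯ < σ(km)}` of values on the block `k`. -/
def BlockPerm.block {n m : ℕ} (σ : BlockPerm n m) (k : Fin n) : Fin m ↪o Fin (n * m) :=
  OrderEmbedding.ofStrictMono _ (σ.2 k)

/-- The hyper-Pfaffian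
`P̃f_m(X) = ∑_{σ ∈ Π} S̃(σ) x_{σ(mn)⋯σ(mn-m+1)} ⋯ x_{σ(m)⋯σ(1)}` of a family `x_I` in an algebra `A`;
`act f` is the element of `A` by whose left multiplication the function `f` acts on `A`. -/
def hyperPfTilde (ℓ : ℂ) {n m : ℕ} {A : Type} [Ring A] (act : Mero (n * m) → A)
    (X : (Fin m ↪o Fin (n * m)) → A) : A :=
  ∑ σ : BlockPerm n m, act (genSignTilde ℓ σ.1 (RelEmbedding.refl _)) *
    (List.ofFn fun k : Fin n => X (σ.block k.rev)).prod

/-! ### Weight spaces -/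

/-- Linear span of all words of total degree `γ` in the elements `g x`, `x` having degree
`deg x`. -/
def wordSpan {X A Γ : Type} [Ring A] [Algebra ℂ A] [AddCommMonoid Γ] (g : X → A) (deg : X → Γ)
    (γ : Γ) : Submodule ℂ A :=
  Submodule.span ℂ {a | ∃ w : List X, (w.map deg).sum = γ ∧ a = (w.map g).prod}

section wordSpan

variable {X A Γ : Type} [Ring A] [Algebra ℂ A] [AddCommMonoid Γ] {g : X → A} {deg : X → Γ}

theorem wordSpan_one : (1 : A) ∈ wordSpan g deg 0 :=
  Submodule.subset_span ⟨[], by simp, by simp⟩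

theorem wordSpan_gen (x : X) : g x ∈ wordSpan g deg (deg x) :=
  Submodule.subset_span ⟨[x], by simp, by simp⟩

theorem wordSpan_mul {γ δ : Γ} {a b : A} (ha : a ∈ wordSpan g deg γ)
    (hb : b ∈ wordSpan g deg δ) : a * b ∈ wordSpan g deg (γ + δ) := by
  have h := Submodule.mul_mem_mul ha hb
  rw [wordSpan, wordSpan, Submodule.span_mul_span] at h
  refine Submodule.span_mono ?_ h
  rintro _ ⟨_, ⟨v, hv, rfl⟩, _, ⟨w, hw, rfl⟩, rfl⟩
  exact ⟨v ++ w, by simp [hv, hw], by simp⟩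

theorem wordSpan_prod {r : ℕ} (a : Fin r → A) (γ : Fin r → Γ)
    (h : ∀ k, a k ∈ wordSpan g deg (γ k)) :
    (List.ofFn a).prod ∈ wordSpan g deg (∑ k, γ k) := by
  induction r with
  | zero => simpa using wordSpan_one
  | succ r ih =>
    rw [List.ofFn_succ, List.prod_cons, Fin.sum_univ_succ]
    exact wordSpan_mul (h 0) (ih _ _ fun k => h k.succ)

end wordSpan

/-- Bidegrees: `t_{ij}` has bidegree `(ω(i), ω(j))`, and `f(λ)`, `f(μ)` have bidegree `0`. -/
def MatGen.deg {N : ℕ} : MatGen N → (Fin N → ℂ) × (Fin N → ℂ)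
  | .t i j => (wt i, wt j)
  | .lam _ => 0
  | .mu _ => 0

/-- Weights: `b̃_I` has weight `ω(I)`, and `f` has weight `0`. -/
def PfGen.deg {N m : ℕ} : PfGen N m → (Fin N → ℂ)
  | .b I => wtSet I
  | .scal _ => 0

/-- The bihomogeneous component `F_R(M(N))_{αβ}`. -/
def matWt (ℓ : ℂ) {N : ℕ} (α β : Fin N → ℂ) : Submodule ℂ (MatAlg ℓ N) :=
  wordSpan (MatAlg.gen ℓ) MatGen.deg (α, β)

theorem matWt_mul {ℓ : ℂ} {N : ℕ} {α β α' β' : Fin N → ℂ} {t t' : MatAlg ℓ N}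
    (ht : t ∈ matWt ℓ α β) (ht' : t' ∈ matWt ℓ α' β') :
    t * t' ∈ matWt ℓ (α + α') (β + β') := by
  rw [matWt] at *
  rw [← Prod.mk_add_mk]
  exact wordSpan_mul ht ht'

/-- The weight space `B̃_α`. -/
def pfWt {N : ℕ} (m : ℕ) (α : Fin N → ℂ) : Submodule ℂ (PfAlg N m) :=
  wordSpan PfAlg.gen PfGen.deg α

/-! ### The algebra `B̃ ⊗̃ F_R(M(N))` -/

/-- The pure tensors `b ⊗ t` with `b ∈ B̃_α` and `t ∈ F_{αβ}`, in `B̃ ⊗ F_R(M(N))` over `ℂ`. -/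
def matched (ℓ : ℂ) (N m : ℕ) : Set (PfAlg N m ⊗[ℂ] MatAlg ℓ N) :=
  {x | ∃ α β : Fin N → ℂ, ∃ b ∈ pfWt m α, ∃ t ∈ matWt ℓ α β, x = b ⊗ₜ[ℂ] t}

theorem one_mem_matched (ℓ : ℂ) (N m : ℕ) : 1 ∈ matched ℓ N m :=
  ⟨0, 0, 1, wordSpan_one, 1, wordSpan_one, rfl⟩

theorem mul_mem_matched (ℓ : ℂ) (N m : ℕ) (x y : PfAlg N m ⊗[ℂ] MatAlg ℓ N)
    (hx : x ∈ matched ℓ N m) (hy : y ∈ matched ℓ N m) : x * y ∈ matched ℓ N m := by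
  obtain ⟨α, β, b, hb, t, ht, rfl⟩ := hx
  obtain ⟨α', β', b', hb', t', ht', rfl⟩ := hy
  exact ⟨α + α', β + β', b * b', wordSpan_mul hb hb', t * t', matWt_mul ht ht',
    Algebra.TensorProduct.tmul_mul_tmul b b' t t'⟩

theorem span_mul_mem {A : Type} [Ring A] [Algebra ℂ A] (s : Set A)
    (hs : ∀ x y, x ∈ s → y ∈ s → x * y ∈ s) (x y : A) (hx : x ∈ Submodule.span ℂ s)
    (hy : y ∈ Submodule.span ℂ s) : x * y ∈ Submodule.span ℂ s := by
  have h := Submodule.mul_mem_mul hx hy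
  rw [Submodule.span_mul_span] at h
  refine Submodule.span_mono ?_ h
  rintro _ ⟨a, ha, b, hb, rfl⟩
  exact hs a b ha hb

/-- The subalgebra `⊕_{α,β} B̃_α ⊗ F_{αβ}` of `B̃ ⊗ F_R(M(N))` (tensor product over `ℂ`, with
`(b ⊗ t)(b' ⊗ t') = bb' ⊗ tt'`). -/
def preTensor (ℓ : ℂ) (N m : ℕ) : Subalgebra ℂ (PfAlg N m ⊗[ℂ] MatAlg ℓ N) :=
  Submodule.toSubalgebra (Submodule.span ℂ (matched ℓ N m))
    (Submodule.subset_span (one_mem_matched ℓ N m))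
    (span_mul_mem _ (mul_mem_matched ℓ N m))

/-- The relations `f b ⊗ t = b ⊗ μ_l(f) t`, for `b ∈ B̃_α` and `t ∈ F_{αβ}`. -/
def tensorRel (ℓ : ℂ) (N m : ℕ) (x y : preTensor ℓ N m) : Prop :=
  ∃ (α β : Fin N → ℂ) (f : Mero N), ∃ b ∈ pfWt m α, ∃ t ∈ matWt ℓ α β,
    (x : PfAlg N m ⊗[ℂ] MatAlg ℓ N) = (scal f * b) ⊗ₜ t ∧
    (y : PfAlg N m ⊗[ℂ] MatAlg ℓ N) = b ⊗ₜ (muL ℓ f * t)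

/-- The algebra `B̃ ⊗̃ F_R(M(N))`: the quotient of `⊕_{α,β} B̃_α ⊗ F_{αβ}` by the relations
`f b ⊗ t = b ⊗ μ_l(f) t`. -/
abbrev DynTensor (ℓ : ℂ) (N m : ℕ) : Type := RingQuot (tensorRel ℓ N m)

/-- The element `b ⊗ t` of `B̃ ⊗̃ F_R(M(N))`, for `b ∈ B̃_α` and `t ∈ F_{αβ}`. -/
def dynTmul (ℓ : ℂ) {N m : ℕ} {α β : Fin N → ℂ} (b : pfWt m α) (t : matWt ℓ α β) :
    DynTensor ℓ N m :=
  RingQuot.mkRingHom (tensorRel ℓ N m)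
    ⟨b.1 ⊗ₜ t.1, Submodule.subset_span ⟨α, β, b.1, b.2, t.1, t.2, rfl⟩⟩

/-! ### Weights of the elements in question -/

theorem one_mem_pfWt (N m : ℕ) : (1 : PfAlg N m) ∈ pfWt m (0 : Fin N → ℂ) := wordSpan_one

theorem muR_mem (ℓ : ℂ) {N : ℕ} (f : Mero N) : muR ℓ f ∈ matWt ℓ (0 : Fin N → ℂ) 0 :=
  wordSpan_gen (MatGen.mu f)

theorem bgen_mem {N m : ℕ} (I : Fin m ↪o Fin N) : bgen I ∈ pfWt m (wtSet I) :=
  wordSpan_gen (PfGen.b I)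

theorem minor_mem (ℓ : ℂ) {N r : ℕ} (ρ : Equiv.Perm (Fin r)) (I J : Fin r ↪o Fin N) :
    minor ℓ ρ I J ∈ matWt ℓ (wtSet I) (wtSet J) := by
  have key : ∀ σ : Equiv.Perm (Fin r),
      muL ℓ (genSign ℓ σ I) * (List.ofFn fun k : Fin r => tgen ℓ (I (σ k)) (J (ρ k))).prod
        ∈ matWt ℓ (wtSet I) (wtSet J) := by
    intro σ
    have h1 := wordSpan_prod (g := MatAlg.gen ℓ) (deg := MatGen.deg)
      (fun k : Fin r => tgen ℓ (I (σ k)) (J (ρ k)))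
      (fun k => (wt (I (σ k)), wt (J (ρ k)))) (fun k => wordSpan_gen (MatGen.t _ _))
    have h2 := wordSpan_mul
      (wordSpan_gen (g := MatAlg.gen ℓ) (deg := MatGen.deg) (MatGen.lam (genSign ℓ σ I))) h1
    have h3 : MatGen.deg (MatGen.lam (genSign ℓ σ I)) +
        ∑ k, ((wt (I (σ k)), wt (J (ρ k))) : (Fin N → ℂ) × (Fin N → ℂ)) =
        (wtSet I, wtSet J) := by
      refine (zero_add _).trans (Prod.ext ?_ ?_)
      · rw [Prod.fst_sum]; exact Equiv.sum_comp σ (fun k => wt (I k))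
      · rw [Prod.snd_sum]; exact Equiv.sum_comp ρ (fun k => wt (J k))
    rw [h3] at h2
    exact h2
  have h := wordSpan_mul (muR_mem ℓ (genSign ℓ ρ J)⁻¹)
    (Submodule.sum_mem _ fun σ (_ : σ ∈ Finset.univ) => key σ)
  have h0 : (((0 : Fin N → ℂ), (0 : Fin N → ℂ)) + (wtSet I, wtSet J)) = (wtSet I, wtSet J) :=
    zero_add _
  rw [h0] at h
  exact h

/-- `P̃f_m(B̃)` in `B̃`. -/
def pfB (ℓ : ℂ) (n m : ℕ) : PfAlg (n * m) m := hyperPfTilde ℓ scal bgen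

theorem pfB_mem (ℓ : ℂ) (n m : ℕ) :
    pfB ℓ n m ∈ pfWt m (wtSet (RelEmbedding.refl _ : Fin (n * m) ↪o Fin (n * m))) := by
  refine Submodule.sum_mem _ fun σ _ => ?_
  have h1 := wordSpan_prod (g := PfAlg.gen) (deg := PfGen.deg)
    (fun k : Fin n => bgen (σ.block k.rev)) (fun k => wtSet (σ.block k.rev))
    (fun k => bgen_mem _)
  have h2 := wordSpan_mul (wordSpan_gen (g := PfAlg.gen) (deg := PfGen.deg)
    (PfGen.scal (m := m) (genSignTilde ℓ σ.1 (RelEmbedding.refl _)))) h1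
  have h3 : PfGen.deg (PfGen.scal (m := m) (genSignTilde ℓ σ.1 (RelEmbedding.refl _))) +
      ∑ k : Fin n, wtSet (σ.block k.rev) =
      wtSet (RelEmbedding.refl _ : Fin (n * m) ↪o Fin (n * m)) := by
    have e1 : ∑ k : Fin n, wtSet (σ.block k.rev) = ∑ k : Fin n, wtSet (σ.block k) :=
      Equiv.sum_comp Fin.revPerm (fun k => wtSet (σ.block k))
    have e2 : ∑ k : Fin n, wtSet (σ.block k) = ∑ p : Fin (n * m), wt (σ.1 p) := by
      rw [← Equiv.sum_comp finProdFinEquiv, Fintype.sum_prod_type]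
      rfl
    rw [e1, e2, Equiv.sum_comp σ.1 (fun p => wt p)]
    exact zero_add _
  rw [h3] at h2
  exact h2

/-- The element `1 ⊗ μ_r(f)`; left multiplication by it is `f (b ⊗ t) = b ⊗ μ_r(f) t`. -/
def dynAct (ℓ : ℂ) {N : ℕ} (m : ℕ) (f : Mero N) : DynTensor ℓ N m :=
  dynTmul ℓ ⟨1, one_mem_pfWt N m⟩ ⟨muR ℓ f, muR_mem ℓ f⟩

instance (N m : ℕ) : Fintype (Fin m ↪o Fin N) :=
  Fintype.ofInjective (fun I : Fin m ↪o Fin N => (I : Fin m → Fin N)) DFunLike.coe_injective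

/-- `c_I = ∑_J b̃_J ⊗ ξ^J_I`, the minor `ξ^J_I` being written with the permutation `ρ J I`. -/
def cElt (ℓ : ℂ) {N m : ℕ}
    (ρ : (Fin m ↪o Fin N) → (Fin m ↪o Fin N) → Equiv.Perm (Fin m)) (I : Fin m ↪o Fin N) :
    DynTensor ℓ N m :=
  ∑ J : Fin m ↪o Fin N, dynTmul ℓ ⟨bgen J, bgen_mem J⟩ ⟨minor ℓ (ρ J I) J I, minor_mem ℓ (ρ J I) J I⟩

end DynPfaffian

end

/-! Expanding every c_I writes the left side as a sum over n-tuples (J_1, …, J_n) of m-subsets of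
b̃_{J_1} ⋯ b̃_{J_n} ⊗ E(J). Here E(J) is the sum over block permutations σ of μ_r(S̃(σ)) times the
product of the minors with rows J_k whose columns are the blocks of σ, last block first. The theorem
amounts to an evaluation of E(J). If J lists the blocks of a block permutation π, last one first,
then E(J) = μ_l(S̃(π)) det(T); otherwise E(J) = 0. The defining relation of the tensor product then
carries S̃(π) to the left factor, where the terms sum to the hyper-Pfaffian of B̃.

E(J) is a Laplace expansion, provided that the minors are available as sums over orderings of their
columns, whereas their definition sums over orderings of rows. Two facts give the passage.

(1) The RTT relations imply a two-letter exchange rule. Antisymmetrizing t_{ik} t_{jl} over its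
columns gives an expression that picks up the factor -h(λ_i - λ_j) when the rows i < j are
interchanged, and that vanishes for i = j. The same holds with rows and columns exchanged.
`ExchangeSystem` covers both cases, and induction over adjacent transpositions extends the rule to
words of any length (`antisymm_comp_perm`, `antisymm_eq_zero`).

(2) Antisymmetrizing over rows and columns at once, and carrying out the two sums in either order,
shows that the row and the column antisymmetrization agree up to a common factor
(`minor_eq_antisymm`). This factor is, up to sign, the q-factorial of r, by a symmetrization
identity that follows from Lagrange interpolation. It is a nonzero constant because q is not a root
of unity.

The column form of the minors turns E(J) into the column antisymmetrization of one word of length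
nm, whose rows are J_1, …, J_n, each in decreasing order (`sum_blockPerm_antisymm`). Repeated rows
make it vanish; distinct rows are sorted at the cost of S̃(π). -/

noncomputable section

open scoped TensorProduct

namespace DynPfaffian

/-! ### The function `h` and shifts -/

section hfun

variable {ℓ : ℂ} {N : ℕ}

/-- The entire function `λ ↦ q^{-2 λ_i}`. -/
def expEntire (ℓ : ℂ) {N : ℕ} (i : Fin N) : Entire N :=
  ⟨fun x => Complex.exp (ℓ * (-2 * x i)), fun x _ =>
    (analyticAt_const.mul (analyticAt_const.mul
      ((ContinuousLinearMap.proj (R := ℂ) (φ := fun _ : Fin N => ℂ) i).analyticAt x))).cexp⟩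

/-- The meromorphic function `q^{-2 λ_i}`. -/
def expMero (ℓ : ℂ) {N : ℕ} (i : Fin N) : Mero N := algebraMap (Entire N) (Mero N) (expEntire ℓ i)

/-- The constant `q` as a meromorphic function. -/
def qMero (ℓ : ℂ) (N : ℕ) : Mero N := algebraMap ℂ (Mero N) (Complex.exp ℓ)

theorem algebraMap_entire_injective : Function.Injective (algebraMap (Entire N) (Mero N)) :=
  IsFractionRing.injective _ _

theorem qMero_eq : qMero ℓ N = algebraMap (Entire N) (Mero N) (algebraMap ℂ _ (Complex.exp ℓ)) :=
  IsScalarTower.algebraMap_apply _ _ _ _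

theorem qMero_ne_zero : qMero ℓ N ≠ 0 := by
  simp [qMero, Complex.exp_ne_zero]

theorem expMero_ne_zero (i : Fin N) : expMero ℓ i ≠ 0 := by
  intro h
  have h0 : expEntire ℓ i = 0 := algebraMap_entire_injective (by rw [map_zero]; exact h)
  exact Complex.exp_ne_zero _ (congrFun (congrArg Subtype.val h0) 0)

theorem expMero_injective (hq : Complex.exp ℓ ^ 2 ≠ 1) :
    Function.Injective (expMero ℓ : Fin N → Mero N) := by
  intro i j h
  by_contra hij
  have h0 : expEntire ℓ i = expEntire ℓ j := algebraMap_entire_injective h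
  -- The point e_i separates the two functions: q^{-2} on one side, 1 on the other.
  have h1 := congrFun (congrArg Subtype.val h0) (Pi.single i 1)
  simp only [expEntire, Pi.single_eq_same, Pi.single_eq_of_ne' hij, mul_zero, mul_one,
    Complex.exp_zero] at h1
  apply hq
  rw [← Complex.exp_nat_mul, ← inv_inj, ← Complex.exp_neg, inv_one, ← h1]
  congr 1
  push_cast
  ring

theorem qMero_sq_mul_expMero_ne (hq : Complex.exp ℓ ^ 2 ≠ 1) (i j : Fin N) :
    qMero ℓ N ^ 2 * expMero ℓ i ≠ expMero ℓ j := by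
  rw [qMero_eq, expMero, expMero, ← map_pow, ← map_mul]
  intro h
  have h1 := congrFun (congrArg Subtype.val (algebraMap_entire_injective h)) 0
  have h2 : Complex.exp ℓ ^ 2 * Complex.exp (ℓ * (-2 * 0)) = Complex.exp (ℓ * (-2 * 0)) := h1
  rw [mul_zero, mul_zero, Complex.exp_zero, mul_one] at h2
  exact hq h2

theorem qpow_mul (i j : Fin N) : qpow ℓ i j * expEntire ℓ j = expEntire ℓ i := by
  refine Subtype.ext (funext fun x => ?_)
  change Complex.exp _ * Complex.exp _ = Complex.exp _
  rw [← Complex.exp_add]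
  congr 1
  ring

/-- In the variables x_i = q^{-2λ_i} the function h becomes a quotient of a q-difference by a
difference, the form in which products of h can be symmetrized. For i = j both sides are 0 by the
convention for division by zero. -/
theorem hfun_eq (i j : Fin N) :
    hfun ℓ i j = (qMero ℓ N * expMero ℓ i - (qMero ℓ N)⁻¹ * expMero ℓ j) /
      (expMero ℓ i - expMero ℓ j) := by
  have hj := expMero_ne_zero (ℓ := ℓ) j
  have hQ := qMero_ne_zero (ℓ := ℓ) (N := N)
  have h1 : algebraMap (Entire N) (Mero N) (qpow ℓ i j) = expMero ℓ i / expMero ℓ j := by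
    rw [eq_div_iff hj, expMero, expMero, ← map_mul, qpow_mul]
  have h2 : expMero ℓ i / expMero ℓ j - 1 = (expMero ℓ i - expMero ℓ j) / expMero ℓ j := by
    field_simp
  rw [hfun, h1, h2, map_pow, map_inv₀, ← qMero]
  by_cases h : expMero ℓ i - expMero ℓ j = 0
  · simp [h]
  · field_simp

theorem hfun_ne_zero (hq : Complex.exp ℓ ^ 2 ≠ 1) {i j : Fin N} (hij : i ≠ j) :
    hfun ℓ i j ≠ 0 := by
  have hQ := qMero_ne_zero (ℓ := ℓ) (N := N)
  rw [hfun_eq]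
  refine div_ne_zero (fun h => qMero_sq_mul_expMero_ne hq i j ?_)
    (sub_ne_zero.mpr ((expMero_injective hq).ne hij))
  field_simp at h
  linear_combination h

theorem hfun_add_hfun (hq : Complex.exp ℓ ^ 2 ≠ 1) {i j : Fin N} (hij : i ≠ j) :
    hfun ℓ i j + hfun ℓ j i = qMero ℓ N + (qMero ℓ N)⁻¹ := by
  have h1 := sub_ne_zero.mpr ((expMero_injective hq).ne hij)
  have h2 := sub_ne_zero.mpr ((expMero_injective hq).ne hij.symm)
  have h3 : expMero ℓ j - expMero ℓ i = -(expMero ℓ i - expMero ℓ j) := by ring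
  rw [hfun_eq, hfun_eq, h3, div_neg, ← sub_eq_add_neg, ← sub_div, div_eq_iff h1]
  ring

theorem shift_algebraMap (α : Fin N → ℂ) (f : Entire N) :
    shift α (algebraMap _ _ f) = algebraMap (Entire N) (Mero N) (shiftEntire α f) := by
  simp only [shift, IsFractionRing.map, IsLocalization.map_eq]

theorem shift_const (α : Fin N → ℂ) (c : ℂ) :
    shift α (algebraMap ℂ (Mero N) c) = algebraMap ℂ (Mero N) c := by
  rw [IsScalarTower.algebraMap_apply ℂ (Entire N) (Mero N), shift_algebraMap]
  rfl

theorem shift_shift (α β : Fin N → ℂ) (f : Mero N) : shift α (shift β f) = shift (α + β) f := by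
  obtain ⟨a, b, -, rfl⟩ := IsFractionRing.div_surjective (A := Entire N) f
  simp only [map_div₀, shift_algebraMap]
  congr 2 <;>
  · refine Subtype.ext (funext fun x => ?_)
    simp [shiftEntire, add_assoc]

theorem shift_zero (f : Mero N) : shift (0 : Fin N → ℂ) f = f := by
  obtain ⟨a, b, -, rfl⟩ := IsFractionRing.div_surjective (A := Entire N) f
  simp only [map_div₀, shift_algebraMap]
  congr 2 <;>
  · refine Subtype.ext (funext fun x => ?_)
    simp [shiftEntire]

theorem shift_hfun {α : Fin N → ℂ} {i j : Fin N} (h : α i = α j) :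
    shift α (hfun ℓ i j) = hfun ℓ i j := by
  have h1 : shiftEntire α (qpow ℓ i j) = qpow ℓ i j := by
    refine Subtype.ext (funext fun x => ?_)
    simp [shiftEntire, qpow, h]
  rw [hfun, RingHom.map_mul, map_div₀, RingHom.map_sub, RingHom.map_sub, RingHom.map_one,
    shift_const, shift_const, shift_algebraMap, h1]

end hfun

/-! ### Symmetrization of a product of `q`-differences -/

section qsum

variable {K : Type*} [Field K]

-- Lagrange interpolation of P(z) = ∏_j (q z - q⁻¹ x_j) at the nodes x_i and one extra node 0,
-- compared in top degree. The leading coefficient is q^n with n the number of the x_i, the node 0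
-- contributes q^{-n}, and the node x_i contributes q - q⁻¹ times the i-th summand, since the factor
-- j = i of P(x_i) is (q - q⁻¹) x_i.
open Polynomial in
theorem sum_prod_qdiff {ι : Type*} [Fintype ι] [DecidableEq ι] {q : K} (hq0 : q ≠ 0)
    (hq : q ^ 2 ≠ 1) (x : ι → K) (hx : Function.Injective x) (hx0 : ∀ i, x i ≠ 0) :
    ∑ i, ∏ j ∈ Finset.univ.erase i, (q * x i - q⁻¹ * x j) / (x i - x j) =
      (q ^ Fintype.card ι - (q ^ Fintype.card ι)⁻¹) / (q - q⁻¹) := by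
  have hqq : q - q⁻¹ ≠ 0 := fun h => hq (by field_simp at h; linear_combination h)
  let v : Option ι → K := fun o => o.elim 0 x
  have hv : Function.Injective v := by
    rintro (_ | i) (_ | j) h
    · rfl
    · exact absurd h.symm (hx0 j)
    · exact absurd h (hx0 i)
    · exact congrArg some (hx h)
  let P : K[X] := ∏ j, (C q * X - C (q⁻¹ * x j))
  have hdeg1 : ∀ j, (C q * X - C (q⁻¹ * x j)).natDegree = 1 := fun j => by
    rw [natDegree_sub_C, natDegree_C_mul_X _ hq0]
  have hlead1 : ∀ j, (C q * X - C (q⁻¹ * x j)).leadingCoeff = q := fun j => by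
    rw [leadingCoeff, hdeg1]; simp [coeff_C]
  have hne : ∀ j, C q * X - C (q⁻¹ * x j) ≠ 0 := fun j h => by
    have := hdeg1 j
    rw [h] at this; simp at this
  have hP : P.natDegree = Fintype.card ι := by
    rw [natDegree_prod _ _ fun j _ => hne j]
    simp only [hdeg1, Finset.sum_const, Finset.card_univ, smul_eq_mul, mul_one]
  have hP0 : P ≠ 0 := Finset.prod_ne_zero_iff.mpr fun j _ => hne j
  have hcoeff : P.coeff (Fintype.card ι) = q ^ Fintype.card ι := by
    rw [← hP, coeff_natDegree, hP, leadingCoeff_prod]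
    simp only [hlead1, Finset.prod_const, Finset.card_univ]
  have heval : ∀ z, P.eval z = ∏ j, (q * z - q⁻¹ * x j) := fun z => by
    simp [P, eval_prod]
  have key := Lagrange.coeff_eq_sum (s := Finset.univ) (v := v) hv.injOn (P := P) (by
    rw [degree_eq_natDegree hP0, hP, Finset.card_univ, Fintype.card_option]
    exact_mod_cast Nat.lt_succ_self _)
  rw [Finset.card_univ, Fintype.card_option, Nat.add_sub_cancel, hcoeff, Fintype.sum_option] at key
  have hnone : (Finset.univ : Finset (Option ι)).erase none = Finset.univ.map
      Function.Embedding.some := by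
    ext (_ | i) <;> simp
  have hsome : ∀ i, (Finset.univ : Finset (Option ι)).erase (some i) =
      insert none ((Finset.univ.erase i).map Function.Embedding.some) := by
    intro i
    ext (_ | j) <;> simp
  have h1 : P.eval (v none) / ∏ j ∈ Finset.univ.erase none, (v none - v j) =
      (q ^ Fintype.card ι)⁻¹ := by
    rw [hnone, Finset.prod_map, heval, ← Finset.prod_div_distrib]
    have : ∀ j, (q * v none - q⁻¹ * x j) / (v none - v (Function.Embedding.some j)) = q⁻¹ := by
      intro j
      have := hx0 j
      simp only [v, Option.elim, Function.Embedding.some_apply]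
      field_simp
      simp
    rw [Finset.prod_congr rfl fun j _ => this j, Finset.prod_const, Finset.card_univ, inv_pow]
  have h2 : ∀ i, P.eval (v (some i)) / ∏ j ∈ Finset.univ.erase (some i), (v (some i) - v j) =
      (q - q⁻¹) * ∏ j ∈ Finset.univ.erase i, (q * x i - q⁻¹ * x j) / (x i - x j) := by
    intro i
    rw [hsome, Finset.prod_insert (by simp), Finset.prod_map, heval,
      ← Finset.mul_prod_erase _ _ (Finset.mem_univ i), Finset.prod_div_distrib]
    have := hx0 i
    simp only [v, Option.elim, Function.Embedding.some_apply, sub_zero]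
    rw [mul_div_mul_comm]
    congr 1
    field_simp
  rw [h1, Finset.sum_congr rfl fun i _ => h2 i, ← Finset.mul_sum] at key
  rw [eq_div_iff hqq]
  linear_combination -key

/-- Induction on r: once the first value p of the permutation is fixed, the sum over the rest does
not depend on which variables remain, and the sum over p is `sum_prod_qdiff`. The result is the
q-factorial. -/
theorem sum_perm_prod_qdiff {q : K} (hq0 : q ≠ 0) (hq : q ^ 2 ≠ 1) :
    ∀ (r : ℕ) (x : Fin r → K), Function.Injective x → (∀ i, x i ≠ 0) →
      ∑ ρ : Equiv.Perm (Fin r), ∏ k, ∏ l, (if k < l then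
        (q * x (ρ k) - q⁻¹ * x (ρ l)) / (x (ρ k) - x (ρ l)) else 1) =
      ∏ s ∈ Finset.range r, (q ^ (s + 1) - (q ^ (s + 1))⁻¹) / (q - q⁻¹) := by
  intro r
  induction r with
  | zero => intro x _ _; simp
  | succ r ih =>
    intro x hx hx0
    rw [← Equiv.sum_comp Equiv.Perm.decomposeFin.symm, Fintype.sum_prod_type,
      Finset.prod_range_succ, mul_comm]
    have h2 := sum_prod_qdiff hq0 hq x hx hx0
    rw [Fintype.card_fin] at h2
    rw [← h2, Finset.sum_mul]
    refine Finset.sum_congr rfl fun p _ => ?_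
    have hinj : Function.Injective fun k : Fin r => x (Equiv.swap 0 p k.succ) :=
      hx.comp ((Equiv.swap 0 p).injective.comp (Fin.succ_injective r))
    rw [← ih _ hinj fun i => hx0 _, Finset.mul_sum]
    refine Finset.sum_congr rfl fun e _ => ?_
    rw [Fin.prod_univ_succ]
    congr 1
    · rw [Fin.prod_univ_succ]
      simp only [lt_self_iff_false, if_false, one_mul, Fin.succ_pos, if_true,
        Equiv.Perm.decomposeFin_symm_apply_succ, Equiv.Perm.decomposeFin_symm_apply_zero]
      have h3 := Equiv.prod_comp e fun l : Fin r =>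
        (q * x p - q⁻¹ * x (Equiv.swap 0 p l.succ)) / (x p - x (Equiv.swap 0 p l.succ))
      rw [h3]
      symm
      -- The transposition of 0 and p carries the nonzero indices onto the indices other than p.
      refine Finset.prod_bij' (fun j hj => (Equiv.swap 0 p j).pred ?_)
        (fun l _ => Equiv.swap 0 p l.succ) ?_ ?_ ?_ ?_ ?_
      · intro h
        exact (Finset.ne_of_mem_erase hj)
          ((Equiv.swap 0 p).injective (h.trans (Equiv.swap_apply_right 0 p).symm))
      · intro j hj; exact Finset.mem_univ _
      · intro l hl
        refine Finset.mem_erase.mpr ⟨fun h => ?_, Finset.mem_univ _⟩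
        exact (Fin.succ_ne_zero l)
          ((Equiv.swap 0 p).injective (h.trans (Equiv.swap_apply_left 0 p).symm))
      · intro j hj; simp
      · intro l hl; simp
      · intro j hj; simp
    · refine Finset.prod_congr rfl fun k _ => ?_
      rw [Fin.prod_univ_succ]
      simp [Equiv.Perm.decomposeFin_symm_apply_succ]

end qsum

/-- Since the value is a complex constant independent of J, both moment maps send it to the same
invertible scalar. It is the q-factorial times the sign (-1)^{r(r-1)/2}. -/
theorem exists_sum_perm_prod_hfun {ℓ : ℂ} (hq : ∀ k : ℕ, 0 < k → Complex.exp ℓ ^ k ≠ 1) (r : ℕ) :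
    ∃ c : ℂ, c ≠ 0 ∧ ∀ (N : ℕ) (J : Fin r → Fin N), Function.Injective J →
      ∑ ρ : Equiv.Perm (Fin r), ∏ k, ∏ l, (if k < l then -hfun ℓ (J (ρ k)) (J (ρ l)) else 1) =
        algebraMap ℂ (Mero N) c := by
  have hq0 := Complex.exp_ne_zero ℓ
  have hs : ∀ s : ℕ, 0 < s → Complex.exp ℓ ^ s - (Complex.exp ℓ ^ s)⁻¹ ≠ 0 := by
    intro s hs h
    have h1 := pow_ne_zero s hq0
    apply hq (2 * s) (by omega)
    field_simp at h
    rw [pow_mul']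
    linear_combination h
  refine ⟨(∏ k : Fin r, ∏ l : Fin r, if k < l then -1 else 1) * ∏ s ∈ Finset.range r,
    (Complex.exp ℓ ^ (s + 1) - (Complex.exp ℓ ^ (s + 1))⁻¹) / (Complex.exp ℓ - (Complex.exp ℓ)⁻¹),
    mul_ne_zero ?_ ?_, ?_⟩
  · refine Finset.prod_ne_zero_iff.mpr fun k _ => Finset.prod_ne_zero_iff.mpr fun l _ => ?_
    split_ifs <;> norm_num
  · refine Finset.prod_ne_zero_iff.mpr fun s _ => div_ne_zero (hs _ s.succ_pos) ?_
    simpa using hs 1 one_pos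
  · intro N J hJ
    have hq2 : qMero ℓ N ^ 2 ≠ 1 := by
      rw [qMero, ← map_pow, ← map_one (algebraMap ℂ (Mero N))]
      exact (algebraMap ℂ (Mero N)).injective.ne (hq 2 two_pos)
    have key := sum_perm_prod_qdiff (qMero_ne_zero (ℓ := ℓ) (N := N)) hq2 r
      (fun i => expMero ℓ (J i)) ((expMero_injective (hq 2 two_pos)).comp hJ)
      (fun i => expMero_ne_zero _)
    have hc : algebraMap ℂ (Mero N) (∏ s ∈ Finset.range r,
        (Complex.exp ℓ ^ (s + 1) - (Complex.exp ℓ ^ (s + 1))⁻¹) /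
          (Complex.exp ℓ - (Complex.exp ℓ)⁻¹)) = ∏ s ∈ Finset.range r,
        (qMero ℓ N ^ (s + 1) - (qMero ℓ N ^ (s + 1))⁻¹) / (qMero ℓ N - (qMero ℓ N)⁻¹) := by
      rw [map_prod]
      refine Finset.prod_congr rfl fun s _ => ?_
      rw [map_div₀, RingHom.map_sub, RingHom.map_sub, map_inv₀, map_inv₀, map_pow, ← qMero]
    have hsgn : algebraMap ℂ (Mero N) (∏ k : Fin r, ∏ l : Fin r, if k < l then -1 else 1) =
        ∏ k : Fin r, ∏ l : Fin r, if k < l then -1 else 1 := by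
      simp only [map_prod, apply_ite (algebraMap ℂ (Mero N)), RingHom.map_neg, RingHom.map_one]
    rw [RingHom.map_mul, hc, hsgn, ← key, Finset.mul_sum]
    refine Finset.sum_congr rfl fun ρ _ => ?_
    simp only [← Finset.prod_mul_distrib]
    refine Finset.prod_congr rfl fun k _ => Finset.prod_congr rfl fun l _ => ?_
    split_ifs
    · rw [hfun_eq, neg_one_mul]
    · rw [mul_one]

/-! ### Exchange systems -/

section exchange

variable {ι K A : Type*} [Field K] [Ring A]

theorem swap_lt_swap_iff {r : ℕ} {p q : Fin r} (hpq : q.1 = p.1 + 1) {x y : Fin r}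
    (h1 : ¬(x = p ∧ y = q)) (h2 : ¬(x = q ∧ y = p)) :
    Equiv.swap p q x < Equiv.swap p q y ↔ x < y := by
  simp only [Equiv.swap_apply_def]
  split_ifs <;> simp only [Fin.lt_def, Fin.ext_iff] at * <;> omega

/-- Isolates two neighbouring letters of a word. The left part is explicit because scalars will be
moved across it; of the right part only its independence of the two letters matters. -/
theorem prod_ofFn_split {M : Type*} [Monoid M] {r : ℕ} (p q : Fin r) (hpq : q.1 = p.1 + 1) :
    ∃ R : (Fin r → M) → M,
      (∀ f : Fin r → M, (List.ofFn f).prod =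
        (List.ofFn fun i : Fin p.1 => f (i.castLE p.2.le)).prod * (f p * f q) * R f) ∧
      ∀ f g : Fin r → M, (∀ k, k ≠ p → k ≠ q → f k = g k) → R f = R g := by
  obtain ⟨p, hp⟩ := p
  obtain ⟨q, hq⟩ := q
  obtain ⟨s, rfl⟩ : ∃ s, r = p + (2 + s) := ⟨r - p - 2, by dsimp at hpq; omega⟩
  dsimp only at hpq
  subst hpq
  refine ⟨fun f => (List.ofFn fun i : Fin s => f (Fin.natAdd p (Fin.natAdd 2 i))).prod, ?_, ?_⟩
  · intro f
    rw [List.ofFn_add, List.prod_append, List.ofFn_add, List.prod_append, ← mul_assoc]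
    congr 2
    simp only [List.ofFn_succ, List.ofFn_zero, List.prod_cons, List.prod_nil, mul_one]
    rfl
  · intro f g h
    refine congrArg List.prod (congrArg List.ofFn (funext fun i => h _ (fun e => ?_) fun e => ?_))
    · have e' : p + (2 + i.1) = p := congrArg Fin.val e
      omega
    · have e' : p + (2 + i.1) = p + 1 := congrArg Fin.val e
      omega

/-- The product of `-h(c_k, c_l)` over all `k < l` such that `lt (c_k) (c_l)`. -/
def pairProd (lt : ι → ι → Prop) [DecidableRel lt] (h : ι → ι → K) {r : ℕ} (c : Fin r → ι) : K :=
  ∏ k, ∏ l, if k < l ∧ lt (c k) (c l) then -h (c k) (c l) else 1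

theorem pairProd_ne_zero {lt : ι → ι → Prop} [DecidableRel lt] {h : ι → ι → K}
    (hne : ∀ i j, lt i j → h i j ≠ 0) {r : ℕ} (c : Fin r → ι) : pairProd lt h c ≠ 0 := by
  refine Finset.prod_ne_zero_iff.mpr fun k _ => Finset.prod_ne_zero_iff.mpr fun l _ => ?_
  split_ifs with hkl
  · exact neg_ne_zero.mpr (hne _ _ hkl.2)
  · exact one_ne_zero

theorem pairProd_eq_one {lt : ι → ι → Prop} [DecidableRel lt] {h : ι → ι → K} {r : ℕ}
    {c : Fin r → ι} (hc : ∀ k l, k < l → ¬lt (c k) (c l)) : pairProd lt h c = 1 :=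
  Finset.prod_eq_one fun k _ => Finset.prod_eq_one fun l _ => if_neg fun hkl => hc k l hkl.1 hkl.2

/-- An adjacent transposition preserves the relative order of every pair of positions except the
transposed one, so a single factor is lost. -/
theorem pairProd_swap {lt : ι → ι → Prop} [DecidableRel lt] (hasymm : ∀ i j, lt i j → ¬lt j i)
    (h : ι → ι → K) {r : ℕ} {p q : Fin r} (hpq : q.1 = p.1 + 1) (c : Fin r → ι)
    (hlt : lt (c p) (c q)) :
    pairProd lt h c = -h (c p) (c q) * pairProd lt h (c ∘ Equiv.swap p q) := by
  have hpq' : p < q := by rw [Fin.lt_def]; omega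
  have h1 : pairProd lt h (c ∘ Equiv.swap p q) = ∏ k, ∏ l,
      if Equiv.swap p q k < Equiv.swap p q l ∧ lt (c k) (c l) then -h (c k) (c l) else 1 := by
    rw [pairProd, ← Equiv.prod_comp (Equiv.swap p q)]
    refine Finset.prod_congr rfl fun k _ => ?_
    rw [← Equiv.prod_comp (Equiv.swap p q)]
    simp only [Function.comp_apply, Equiv.swap_apply_self]
  have h2 : -h (c p) (c q) = ∏ k, ∏ l, if k = p then (if l = q then -h (c p) (c q) else 1)
      else 1 := by
    rw [Finset.prod_eq_single p, Finset.prod_eq_single q]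
    · simp
    · intro l _ hl; simp [hl]
    · simp
    · intro k _ hk; simp [hk]
    · simp
  rw [h1, h2, pairProd, ← Finset.prod_mul_distrib]
  refine Finset.prod_congr rfl fun k _ => ?_
  rw [← Finset.prod_mul_distrib]
  refine Finset.prod_congr rfl fun l _ => ?_
  by_cases e1 : k = p ∧ l = q
  · obtain ⟨rfl, rfl⟩ := e1
    simp [hpq', hlt, hpq'.not_gt]
  · by_cases e2 : k = q ∧ l = p
    · obtain ⟨rfl, rfl⟩ := e2
      simp [hpq'.not_gt, hpq'.ne', hasymm _ _ hlt]
    · have e3 : (if k = p then (if l = q then -h (c p) (c q) else 1) else 1) = 1 := by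
        split_ifs with a b
        · exact absurd ⟨a, b⟩ e1
        · rfl
        · rfl
      rw [e3, one_mul]
      simp only [swap_lt_swap_iff hpq e1 e2]

/-- The word `t_{a_1 b_1} ⋯ t_{a_r b_r}`. -/
def word (t : ι → ι → A) {r : ℕ} (a b : Fin r → ι) : A := (List.ofFn fun k => t (a k) (b k)).prod

/-- Families `t_{ij}` whose two-letter words satisfy the exchange relations needed for the
antisymmetrization with respect to the second index to be antisymmetric in the first one. -/
structure ExchangeSystem (lt : ι → ι → Prop) (h : ι → ι → K) (sh : ι → K →+* K)
    (κ κ' : K →+* A) (t : ι → ι → A) : Prop where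
  asymm : ∀ i j, lt i j → ¬lt j i
  total : ∀ i j, i ≠ j → lt i j ∨ lt j i
  h_ne_zero : ∀ i j, i ≠ j → h i j ≠ 0
  sh_h : ∀ i k l, i ≠ k → i ≠ l → sh i (h k l) = h k l
  comm : ∀ f g, κ f * κ' g = κ' g * κ f
  t_left : ∀ i j f, t i j * κ f = κ (sh i f) * t i j
  t_right : ∀ i j f, t i j * κ' f = κ' (sh j f) * t i j
  same : ∀ i k l, lt k l → -κ' (h k l) * (t i k * t i l) + t i l * t i k = 0
  exch : ∀ i j k l, lt i j → lt k l →
    -κ' (h k l) * (t i k * t j l) + t i l * t j k =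
      -κ (h i j) * (-κ' (h k l) * (t j k * t i l) + t j l * t i k)

/-- Moving a scalar across a word shifts it by the indices of the letters. The function h(k, l) is
unchanged if neither k nor l is among them, which is why distinct indices make the weights behave
like ordinary signs. -/
theorem exists_word_shift {h : ι → ι → K} {sh : ι → K →+* K} {κ : K →+* A} {t : ι → ι → A}
    (ht : ∀ i j f, t i j * κ f = κ (sh i f) * t i j)
    (hh : ∀ i k l, i ≠ k → i ≠ l → sh i (h k l) = h k l) :
    ∀ {r : ℕ} (a : Fin r → ι), ∃ φ : K →+* K,
      (∀ b f, word t a b * κ f = κ (φ f) * word t a b) ∧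
      ∀ k l, (∀ i, a i ≠ k) → (∀ i, a i ≠ l) → φ (h k l) = h k l := by
  intro r
  induction r with
  | zero => exact fun a => ⟨RingHom.id K, fun b f => by simp [word], fun k l _ _ => rfl⟩
  | succ r ih =>
    intro a
    obtain ⟨φ, h1, h2⟩ := ih fun i => a i.succ
    refine ⟨(sh (a 0)).comp φ, fun b f => ?_, fun k l hk hl => ?_⟩
    · have := h1 (fun i => b i.succ) f
      simp only [word] at this ⊢
      rw [List.ofFn_succ, List.prod_cons, mul_assoc, this, ← mul_assoc, ht, mul_assoc]
      rfl
    · rw [RingHom.comp_apply, h2 k l (fun i => hk _) (fun i => hl _), hh _ _ _ (hk 0) (hl 0)]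

theorem sum_perm_pair {M : Type*} [AddCommMonoid M] {r : ℕ} {p q : Fin r} (hpq : p ≠ q)
    {lt : ι → ι → Prop} [DecidableRel lt] (hasymm : ∀ i j, lt i j → ¬lt j i)
    (htotal : ∀ i j, i ≠ j → lt i j ∨ lt j i) {J : Fin r → ι} (hJ : Function.Injective J)
    (G : Equiv.Perm (Fin r) → M) :
    ∑ ρ, G ρ = ∑ ρ with lt (J (ρ p)) (J (ρ q)), (G ρ + G (ρ * Equiv.swap p q)) := by
  rw [← Finset.sum_filter_add_sum_filter_not Finset.univ (fun ρ => lt (J (ρ p)) (J (ρ q))),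
    Finset.sum_add_distrib]
  congr 1
  refine Finset.sum_bij' (fun ρ _ => ρ * Equiv.swap p q) (fun ρ _ => ρ * Equiv.swap p q)
    ?_ ?_ ?_ ?_ ?_
  · intro ρ hρ
    simp only [Finset.mem_filter, Finset.mem_univ, true_and, Equiv.Perm.mul_apply,
      Equiv.swap_apply_left, Equiv.swap_apply_right] at hρ ⊢
    exact (htotal _ _ (hJ.ne (ρ.injective.ne hpq))).resolve_left hρ
  · intro ρ hρ
    simp only [Finset.mem_filter, Finset.mem_univ, true_and, Equiv.Perm.mul_apply,
      Equiv.swap_apply_left, Equiv.swap_apply_right] at hρ ⊢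
    exact hasymm _ _ hρ
  · intro ρ _; simp [mul_assoc]
  · intro ρ _; simp [mul_assoc]
  · intro ρ _; simp [mul_assoc]

/-- The antisymmetrization over the second indices `J` of the words with first indices `a`. -/
def antisymm (lt : ι → ι → Prop) [DecidableRel lt] (h : ι → ι → K) (κ' : K →+* A)
    (t : ι → ι → A) {r : ℕ} (J a : Fin r → ι) : A :=
  ∑ ρ : Equiv.Perm (Fin r), κ' (pairProd lt h (J ∘ ρ)) * word t a (J ∘ ρ)

/-- The transposition multiplies on the right, so that it interchanges neighbouring positions of the
sequence a ∘ ρ. -/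
theorem perm_induction_adjacent {r : ℕ} {P : Equiv.Perm (Fin r) → Prop} (one : P 1)
    (step : ∀ ρ (p q : Fin r), q.1 = p.1 + 1 → P ρ → P (ρ * Equiv.swap p q)) (ρ) : P ρ := by
  cases r with
  | zero => rwa [Subsingleton.elim ρ 1]
  | succ n =>
    have hρ : ρ ∈ Submonoid.closure (Set.range fun i : Fin n => Equiv.swap i.castSucc i.succ) := by
      rw [Equiv.Perm.mclosure_swap_castSucc_succ]
      trivial
    induction hρ using Submonoid.closure_induction_right with
    | one => exact one
    | mul_right x _ y hy ih =>
      obtain ⟨i, rfl⟩ := hy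
      exact step x _ _ (by simp) ih

/-! ### Antisymmetry and vanishing deduced from the exchange relations -/

namespace ExchangeSystem

variable {lt : ι → ι → Prop} {h : ι → ι → K} {sh : ι → K →+* K}
  {κ κ' : K →+* A} {t : ι → ι → A}

theorem h_ne_zero_of_lt (S : ExchangeSystem lt h sh κ κ' t) (i j : ι) (hij : lt i j) :
    h i j ≠ 0 :=
  S.h_ne_zero i j fun e => S.asymm i j hij (e ▸ e ▸ hij)

variable [DecidableRel lt]

/-- Pairing ρ with ρ composed with the transposition of two neighbouring positions leaves a
two-letter antisymmetrizer between unchanged outer factors. The relative weight of the two terms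
reaches the middle unaltered, because the columns to its left differ from the two columns involved.
-/
theorem exists_antisymm_eq (S : ExchangeSystem lt h sh κ κ' t) {r : ℕ} {p q : Fin r}
    (hpq : q.1 = p.1 + 1) {J : Fin r → ι} (hJ : Function.Injective J) :
    ∃ (L R : (Fin r → ι) → Equiv.Perm (Fin r) → A),
      (∀ a ρ, L a ρ = word t (fun i : Fin p.1 => a (i.castLE p.2.le))
        (fun i : Fin p.1 => J (ρ (i.castLE p.2.le)))) ∧
      (∀ a ρ, R (a ∘ Equiv.swap p q) ρ = R a ρ) ∧
      ∀ a, antisymm lt h κ' t J a = ∑ ρ : Equiv.Perm (Fin r) with lt (J (ρ p)) (J (ρ q)),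
        κ' (pairProd lt h (J ∘ ρ ∘ Equiv.swap p q)) *
          (L a ρ * (-κ' (h (J (ρ p)) (J (ρ q))) * (t (a p) (J (ρ p)) * t (a q) (J (ρ q)))
            + t (a p) (J (ρ q)) * t (a q) (J (ρ p))) * R a ρ) := by
  have hne : p ≠ q := fun e => by rw [e] at hpq; omega
  obtain ⟨R, hR1, hR2⟩ := prod_ofFn_split (M := A) p q hpq
  refine ⟨fun a ρ => word t (fun i : Fin p.1 => a (i.castLE p.2.le))
        (fun i : Fin p.1 => J (ρ (i.castLE p.2.le))), fun a ρ => R fun k => t (a k) (J (ρ k)),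
    fun _ _ => rfl, ?_, ?_⟩
  · intro a ρ
    refine hR2 _ _ fun k hk hk' => ?_
    rw [Function.comp_apply, Equiv.swap_apply_of_ne_of_ne hk hk']
  · intro a
    rw [antisymm, sum_perm_pair hne S.asymm S.total hJ]
    refine Finset.sum_congr rfl fun ρ hρ => ?_
    replace hρ := (Finset.mem_filter.mp hρ).2
    have e1 : J ∘ ⇑(ρ * Equiv.swap p q) = (J ∘ ρ) ∘ Equiv.swap p q := rfl
    have hRR : R (fun k => t (a k) (J (ρ (Equiv.swap p q k)))) = R fun k => t (a k) (J (ρ k)) :=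
      hR2 _ _ fun k hk hk' => by rw [Equiv.swap_apply_of_ne_of_ne hk hk']
    have hLL : (List.ofFn fun i : Fin p.1 => t (a (i.castLE p.2.le))
        (J (ρ (Equiv.swap p q (i.castLE p.2.le))))) =
        List.ofFn fun i : Fin p.1 => t (a (i.castLE p.2.le)) (J (ρ (i.castLE p.2.le))) := by
      congr 1
      funext i
      rw [Equiv.swap_apply_of_ne_of_ne] <;> simp only [ne_eq, Fin.ext_iff, Fin.val_castLE] <;> omega
    obtain ⟨φ, hφ1, hφ2⟩ := exists_word_shift (t := fun i j => t j i) (κ := κ')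
      (fun i j f => S.t_right j i f) S.sh_h (fun i : Fin p.1 => J (ρ (i.castLE p.2.le)))
    have hcomm := hφ1 (fun i : Fin p.1 => a (i.castLE p.2.le)) (h (J (ρ p)) (J (ρ q)))
    rw [hφ2] at hcomm
    · rw [e1, pairProd_swap S.asymm h hpq (J ∘ ρ) hρ, ← Function.comp_assoc, map_mul, map_neg]
      have hk := (κ'.map_mul (h (J (ρ p)) (J (ρ q)))
        (pairProd lt h ((J ∘ ρ) ∘ Equiv.swap p q))).symm
      rw [mul_comm, κ'.map_mul] at hk
      simp only [word] at hcomm ⊢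
      simp only [hR1, Function.comp_apply, hRR, hLL, Equiv.swap_apply_left,
        Equiv.swap_apply_right]
      simp only [neg_mul, mul_add, add_mul, mul_neg]
      congr 2
      simp only [← mul_assoc]
      rw [hk, mul_assoc (κ' _) (κ' _), ← hcomm]
      simp only [mul_assoc]
    · intro i e
      have := congrArg Fin.val (ρ.injective (hJ e))
      simp only [Fin.val_castLE] at this
      omega
    · intro i e
      have := congrArg Fin.val (ρ.injective (hJ e))
      simp only [Fin.val_castLE] at this
      omega

/-- The exchange relation is applied to the two middle letters, and the resulting scalar is moved
left past the prefix, which shifts it by φ. For repeated rows φ may alter the scalar, but being a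
map of fields it keeps it nonzero; this is enough for the vanishing result. -/
theorem antisymm_swap (S : ExchangeSystem lt h sh κ κ' t) {r : ℕ} {p q : Fin r}
    (hpq : q.1 = p.1 + 1) {J : Fin r → ι} (hJ : Function.Injective J) (a : Fin r → ι)
    (hlt : lt (a p) (a q)) :
    ∃ φ : K →+* K, (Function.Injective a → φ (h (a p) (a q)) = h (a p) (a q)) ∧
      antisymm lt h κ' t J a =
        κ (-φ (h (a p) (a q))) * antisymm lt h κ' t J (a ∘ Equiv.swap p q) := by
  obtain ⟨L, R, hL, hR, hD⟩ := S.exists_antisymm_eq hpq hJ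
  obtain ⟨φ, hφ1, hφ2⟩ := exists_word_shift (t := t) (κ := κ) S.t_left S.sh_h
    (fun i : Fin p.1 => a (i.castLE p.2.le))
  refine ⟨φ, fun ha => hφ2 _ _ ?_ ?_, ?_⟩
  · intro i e
    have := congrArg Fin.val (ha e)
    simp only [Fin.val_castLE] at this
    omega
  · intro i e
    have := congrArg Fin.val (ha e)
    simp only [Fin.val_castLE] at this
    omega
  · rw [hD, hD, Finset.mul_sum]
    refine Finset.sum_congr rfl fun ρ hρ => ?_
    replace hρ := (Finset.mem_filter.mp hρ).2
    have hLL : L (a ∘ Equiv.swap p q) ρ = L a ρ := by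
      rw [hL, hL]
      congr 1
      funext i
      rw [Function.comp_apply, Equiv.swap_apply_of_ne_of_ne] <;>
        simp only [ne_eq, Fin.ext_iff, Fin.val_castLE] <;> omega
    rw [S.exch _ _ _ _ hlt hρ, hR, hLL]
    simp only [Function.comp_apply, Equiv.swap_apply_left, Equiv.swap_apply_right]
    have h1 := hφ1 (fun i : Fin p.1 => J (ρ (i.castLE p.2.le))) (h (a p) (a q))
    rw [← hL] at h1
    have h2 := S.comm (φ (h (a p) (a q))) (pairProd lt h (J ∘ ρ ∘ Equiv.swap p q))
    simp only [map_neg, neg_mul, mul_neg, neg_inj]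
    rw [← mul_assoc (κ (φ _)), h2, mul_assoc (κ' _) (κ (φ _))]
    congr 1
    rw [← mul_assoc (L a ρ), h1]
    simp only [mul_assoc]

theorem antisymm_eq_zero_of_adjacent (S : ExchangeSystem lt h sh κ κ' t) {r : ℕ} {p q : Fin r}
    (hpq : q.1 = p.1 + 1) {J : Fin r → ι} (hJ : Function.Injective J) (a : Fin r → ι)
    (ha : a p = a q) : antisymm lt h κ' t J a = 0 := by
  obtain ⟨L, R, -, -, hD⟩ := S.exists_antisymm_eq hpq hJ
  rw [hD]
  refine Finset.sum_eq_zero fun ρ hρ => ?_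
  rw [ha, S.same _ _ _ (Finset.mem_filter.mp hρ).2, mul_zero, zero_mul, mul_zero]

/-- A cruder version of `antisymm_comp_perm`, in which the factor is not identified but repeated
rows are allowed. -/
theorem exists_antisymm_perm (S : ExchangeSystem lt h sh κ κ' t) {r : ℕ} {J : Fin r → ι}
    (hJ : Function.Injective J) (a : Fin r → ι) (π : Equiv.Perm (Fin r)) :
    ∃ f : K, antisymm lt h κ' t J (a ∘ π) = κ f * antisymm lt h κ' t J a := by
  induction π using perm_induction_adjacent with
  | one => exact ⟨1, by simp⟩
  | step π p q hpq ih =>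
    obtain ⟨f, hf⟩ := ih
    have e1 : a ∘ ⇑(π * Equiv.swap p q) = (a ∘ π) ∘ Equiv.swap p q := rfl
    have e2 : ((a ∘ π) ∘ Equiv.swap p q) ∘ Equiv.swap p q = a ∘ π := by
      funext k; simp
    rw [e1]
    by_cases hlt : lt ((a ∘ π) p) ((a ∘ π) q)
    · obtain ⟨φ, -, hφ⟩ := S.antisymm_swap hpq hJ (a ∘ π) hlt
      have hne : -φ (h ((a ∘ π) p) ((a ∘ π) q)) ≠ 0 :=
        neg_ne_zero.mpr ((map_ne_zero φ).mpr (S.h_ne_zero_of_lt _ _ hlt))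
      refine ⟨(-φ (h ((a ∘ π) p) ((a ∘ π) q)))⁻¹ * f, ?_⟩
      rw [map_mul, mul_assoc, ← hf, hφ, ← mul_assoc, ← map_mul, inv_mul_cancel₀ hne, map_one,
        one_mul]
    -- Interchanging two equal neighbours leaves the sequence unchanged.
    · by_cases heq : (a ∘ π) p = (a ∘ π) q
      · refine ⟨f, ?_⟩
        rw [← hf]
        congr 1
        funext k
        simp only [Function.comp_apply, Equiv.swap_apply_def] at heq ⊢
        split_ifs with h1 h2
        · rw [h1, heq]
        · rw [h2, heq]
        · rfl
      · have hlt' := (S.total _ _ heq).resolve_left hlt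
        obtain ⟨φ, -, hφ⟩ := S.antisymm_swap hpq hJ ((a ∘ π) ∘ Equiv.swap p q) (by
          simpa using hlt')
        rw [e2, hf, ← mul_assoc, ← map_mul] at hφ
        exact ⟨_, hφ⟩

theorem antisymm_eq_zero (S : ExchangeSystem lt h sh κ κ' t) {r : ℕ} {J : Fin r → ι}
    (hJ : Function.Injective J) {a : Fin r → ι} (ha : ¬Function.Injective a) :
    antisymm lt h κ' t J a = 0 := by
  have key : ∀ i j, i < j → a i = a j → antisymm lt h κ' t J a = 0 := by
    intro i j hij e
    have hlt : i.1 + 1 < r := by have := j.2; rw [Fin.lt_def] at hij; omega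
    -- The second of the two equal rows is brought next to the first; two equal neighbours give 0 by
    -- `same`.
    let k : Fin r := ⟨i.1 + 1, hlt⟩
    obtain ⟨f, hf⟩ := S.exists_antisymm_perm hJ (a ∘ Equiv.swap k j) (Equiv.swap k j)
    have e2 : (a ∘ Equiv.swap k j) ∘ Equiv.swap k j = a := by
      funext k; simp
    rw [e2, S.antisymm_eq_zero_of_adjacent (p := i) (q := k) rfl hJ (a ∘ Equiv.swap k j), mul_zero] at hf
    · exact hf
    · rw [Function.comp_apply, Function.comp_apply, Equiv.swap_apply_left,
        Equiv.swap_apply_of_ne_of_ne _ hij.ne, e]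
      simp [Fin.ext_iff, k]
  simp only [Function.Injective, not_forall] at ha
  obtain ⟨i, j, e, hij⟩ := ha
  rcases lt_or_gt_of_ne hij with h | h
  · exact key i j h e
  · exact key j i h e.symm

/-- The reference sequence a is the one whose `pairProd` is empty. Each adjacent transposition
changes both sides by the same factor, which is not shifted because all rows are distinct. -/
theorem antisymm_comp_perm (S : ExchangeSystem lt h sh κ κ' t) {r : ℕ} {J a : Fin r → ι}
    (hJ : Function.Injective J) (ha : Function.Injective a)
    (hsort : ∀ k l, k < l → ¬lt (a k) (a l)) (π : Equiv.Perm (Fin r)) :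
    antisymm lt h κ' t J (a ∘ π) = κ (pairProd lt h (a ∘ π)) * antisymm lt h κ' t J a := by
  induction π using perm_induction_adjacent with
  | one =>
    change antisymm lt h κ' t J a = κ (pairProd lt h a) * _
    rw [pairProd_eq_one hsort, map_one, one_mul]
  | step π p q hpq ih =>
    have e1 : a ∘ ⇑(π * Equiv.swap p q) = (a ∘ π) ∘ Equiv.swap p q := rfl
    have e2 : ((a ∘ π) ∘ Equiv.swap p q) ∘ Equiv.swap p q = a ∘ π := by
      funext k; simp
    have hinj : Function.Injective (a ∘ π) := ha.comp π.injective
    have hpq' : (a ∘ π) p ≠ (a ∘ π) q := hinj.ne fun e => by rw [e] at hpq; omega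
    rw [e1]
    by_cases hlt : lt ((a ∘ π) p) ((a ∘ π) q)
    · obtain ⟨φ, hφ', hφ⟩ := S.antisymm_swap hpq hJ (a ∘ π) hlt
      have hne : -h ((a ∘ π) p) ((a ∘ π) q) ≠ 0 :=
        neg_ne_zero.mpr (S.h_ne_zero_of_lt _ _ hlt)
      rw [hφ' hinj, ih, pairProd_swap S.asymm h hpq _ hlt, map_mul, mul_assoc] at hφ
      have := congrArg (κ (-h ((a ∘ π) p) ((a ∘ π) q))⁻¹ * ·) hφ
      simp only [← mul_assoc, ← map_mul] at this
      rw [inv_mul_cancel₀ hne, map_one, one_mul, one_mul] at this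
      exact this.symm
    · have hlt' := (S.total _ _ hpq').resolve_left hlt
      have hlt'' : lt (((a ∘ π) ∘ Equiv.swap p q) p) (((a ∘ π) ∘ Equiv.swap p q) q) := by
        simpa using hlt'
      obtain ⟨φ, hφ', hφ⟩ := S.antisymm_swap hpq hJ _ hlt''
      rw [hφ' (hinj.comp (Equiv.injective _)), e2, ih, ← mul_assoc, ← map_mul] at hφ
      rw [hφ, pairProd_swap S.asymm h hpq _ hlt'', e2]

theorem word_mul_pairProd (S : ExchangeSystem lt h sh κ κ' t) {r s : ℕ} (a c : Fin r → ι)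
    (d : Fin s → ι) (hcd : ∀ i j, c i ≠ d j) :
    word t a c * κ' (pairProd lt h d) = κ' (pairProd lt h d) * word t a c := by
  obtain ⟨φ, h1, h2⟩ := exists_word_shift (t := fun i j => t j i) (κ := κ')
    (fun i j f => S.t_right j i f) S.sh_h c
  have h3 : φ (pairProd lt h d) = pairProd lt h d := by
    simp only [pairProd, map_prod]
    refine Finset.prod_congr rfl fun k _ => Finset.prod_congr rfl fun l _ => ?_
    split_ifs
    · rw [map_neg, h2 _ _ (fun i => hcd i k) fun i => hcd i l]
    · exact map_one φ
  have h4 := h1 a (pairProd lt h d)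
  rwa [h3] at h4

end ExchangeSystem
end exchange

/-! ### Minors as row and column antisymmetrizations -/

section minors

variable {ℓ : ℂ} {N : ℕ}

theorem MatAlg.mk_rel {x y : FreeAlgebra ℂ (MatGen N)} (h : MatRel ℓ N x y) :
    RingQuot.mkAlgHom ℂ (MatRel ℓ N) x = RingQuot.mkAlgHom ℂ (MatRel ℓ N) y :=
  RingQuot.mkAlgHom_rel ℂ h

theorem muL_const (c : ℂ) : muL ℓ (algebraMap ℂ (Mero N) c) = algebraMap ℂ (MatAlg ℓ N) c :=
  (MatAlg.mk_rel (MatRel.lam_const c)).trans (AlgHom.commutes _ c)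

theorem muR_const (c : ℂ) : muR ℓ (algebraMap ℂ (Mero N) c) = algebraMap ℂ (MatAlg ℓ N) c :=
  (MatAlg.mk_rel (MatRel.mu_const c)).trans (AlgHom.commutes _ c)

/-- The left moment map as a ring homomorphism. -/
def muLHom (ℓ : ℂ) (N : ℕ) : Mero N →+* MatAlg ℓ N where
  toFun := muL ℓ
  map_one' := by rw [← map_one (algebraMap ℂ (Mero N)), muL_const, map_one]
  map_zero' := by rw [← map_zero (algebraMap ℂ (Mero N)), muL_const, map_zero]
  map_mul' f g := (MatAlg.mk_rel (MatRel.lam_mul f g)).trans (map_mul _ _ _)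
  map_add' f g := (MatAlg.mk_rel (MatRel.lam_add f g)).trans (map_add _ _ _)

/-- The right moment map as a ring homomorphism. -/
def muRHom (ℓ : ℂ) (N : ℕ) : Mero N →+* MatAlg ℓ N where
  toFun := muR ℓ
  map_one' := by rw [← map_one (algebraMap ℂ (Mero N)), muR_const, map_one]
  map_zero' := by rw [← map_zero (algebraMap ℂ (Mero N)), muR_const, map_zero]
  map_mul' f g := (MatAlg.mk_rel (MatRel.mu_mul f g)).trans (map_mul _ _ _)
  map_add' f g := (MatAlg.mk_rel (MatRel.mu_add f g)).trans (map_add _ _ _)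

theorem muL_eq_hom (f : Mero N) : muL ℓ f = muLHom ℓ N f := rfl
theorem muR_eq_hom (f : Mero N) : muR ℓ f = muRHom ℓ N f := rfl

theorem muLHom_mul_muRHom (f g : Mero N) :
    muLHom ℓ N f * muRHom ℓ N g = muRHom ℓ N g * muLHom ℓ N f := by
  have := MatAlg.mk_rel (ℓ := ℓ) (MatRel.lam_mu f g)
  rwa [map_mul, map_mul] at this

theorem muLHom_mul_tgen (f : Mero N) (i j : Fin N) :
    muLHom ℓ N f * tgen ℓ i j = tgen ℓ i j * muLHom ℓ N (shift (wt i) f) := by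
  have := MatAlg.mk_rel (ℓ := ℓ) (MatRel.lam_t f i j)
  rwa [map_mul, map_mul] at this

theorem muRHom_mul_tgen (f : Mero N) (i j : Fin N) :
    muRHom ℓ N f * tgen ℓ i j = tgen ℓ i j * muRHom ℓ N (shift (wt j) f) := by
  have := MatAlg.mk_rel (ℓ := ℓ) (MatRel.mu_t f i j)
  rwa [map_mul, map_mul] at this

theorem tgen_mul_muLHom (i j : Fin N) (f : Mero N) :
    tgen ℓ i j * muLHom ℓ N f = muLHom ℓ N (shift (-wt i) f) * tgen ℓ i j := by
  rw [muLHom_mul_tgen, shift_shift, add_neg_cancel, shift_zero]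

theorem tgen_mul_muRHom (i j : Fin N) (f : Mero N) :
    tgen ℓ i j * muRHom ℓ N f = muRHom ℓ N (shift (-wt j) f) * tgen ℓ i j := by
  rw [muRHom_mul_tgen, shift_shift, add_neg_cancel, shift_zero]

theorem tgen_row {k l : Fin N} (i : Fin N) (hkl : k < l) :
    muRHom ℓ N (hfun ℓ k l) * (tgen ℓ i k * tgen ℓ i l) = tgen ℓ i l * tgen ℓ i k := by
  have := MatAlg.mk_rel (ℓ := ℓ) (MatRel.row i k l hkl)
  rw [map_mul, map_mul, map_mul, mul_assoc] at this
  exact this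

theorem tgen_col {i j : Fin N} (k : Fin N) (hij : i < j) :
    muLHom ℓ N (hfun ℓ j i) * (tgen ℓ j k * tgen ℓ i k) = tgen ℓ i k * tgen ℓ j k := by
  have := MatAlg.mk_rel (ℓ := ℓ) (MatRel.col i j k hij)
  rw [map_mul, map_mul, map_mul, mul_assoc] at this
  exact this

theorem tgen_diag {i j k l : Fin N} (hij : i < j) (hkl : k < l) :
    tgen ℓ i k * tgen ℓ j l = tgen ℓ j l * tgen ℓ i k +
      (muLHom ℓ N (hfun ℓ j i) - muRHom ℓ N (hfun ℓ k l)) * (tgen ℓ j k * tgen ℓ i l) := by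
  have := MatAlg.mk_rel (ℓ := ℓ) (MatRel.diag i j k l hij hkl)
  rw [map_mul, map_add, map_mul, map_mul, map_mul, map_sub, mul_assoc _ _ (_ : RingQuot _)] at this
  exact this

theorem tgen_cross {i j k l : Fin N} (hij : i < j) (hkl : k < l) :
    tgen ℓ i l * tgen ℓ j k =
      muLHom ℓ N (hfun ℓ i j) * muLHom ℓ N (hfun ℓ j i) * (tgen ℓ j k * tgen ℓ i l) +
      (muRHom ℓ N (hfun ℓ k l) - muLHom ℓ N (hfun ℓ i j)) * (tgen ℓ i k * tgen ℓ j l) := by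
  have := MatAlg.mk_rel (ℓ := ℓ) (MatRel.cross i j k l hij hkl)
  rw [map_mul, map_add, map_mul, map_mul, map_mul, map_mul, map_sub, mul_assoc, mul_assoc] at this
  rw [← map_mul]
  exact this

theorem shift_neg_wt_hfun (i k l : Fin N) (hk : i ≠ k) (hl : i ≠ l) :
    shift (-wt i) (hfun ℓ k l) = hfun ℓ k l :=
  shift_hfun (by simp [wt, hk, hl])

/-- Column antisymmetrizations of words in the `t_{ij}` are antisymmetric in the rows. -/
theorem exchangeSystem_row (hq : Complex.exp ℓ ^ 2 ≠ 1) :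
    ExchangeSystem (fun i j : Fin N => i < j) (hfun ℓ) (fun i => shift (-wt i))
      (muLHom ℓ N) (muRHom ℓ N) (tgen ℓ) where
  asymm _ _ h := h.not_gt
  total _ _ h := lt_or_gt_of_ne h
  h_ne_zero _ _ h := hfun_ne_zero hq h
  sh_h := shift_neg_wt_hfun
  comm := muLHom_mul_muRHom
  t_left := tgen_mul_muLHom
  t_right := tgen_mul_muRHom
  same i k l hkl := by rw [neg_mul, tgen_row i hkl, neg_add_cancel]
  exch i j k l hij hkl := by
    -- After `tgen_cross` the terms with h(μ_k - μ_l) t_{ik} t_{jl} cancel; after `tgen_diag` so do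
    -- the terms with h(λ_i - λ_j) h(λ_j - λ_i).
    rw [tgen_cross hij hkl, tgen_diag hij hkl]
    generalize muLHom ℓ N (hfun ℓ i j) = a
    generalize muLHom ℓ N (hfun ℓ j i) = b
    generalize muRHom ℓ N (hfun ℓ k l) = m
    noncomm_ring

/-- Row antisymmetrizations of words in the `t_{ij}` are antisymmetric in the columns. -/
theorem exchangeSystem_col (hq : Complex.exp ℓ ^ 2 ≠ 1) :
    ExchangeSystem (fun i j : Fin N => j < i) (hfun ℓ) (fun i => shift (-wt i))
      (muRHom ℓ N) (muLHom ℓ N) (fun i j => tgen ℓ j i) where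
  asymm _ _ h := h.not_gt
  total _ _ h := (lt_or_gt_of_ne h).symm
  h_ne_zero _ _ h := hfun_ne_zero hq h
  sh_h := shift_neg_wt_hfun
  comm f g := (muLHom_mul_muRHom g f).symm
  t_left i j f := tgen_mul_muRHom j i f
  t_right i j f := tgen_mul_muLHom j i f
  same i k l hkl := by rw [neg_mul, tgen_col i hkl, neg_add_cancel]
  exch L K J I hKL hIJ := by
    -- The sum h(z) + h(-z) = q + q⁻¹ is the same constant in λ and in μ, so h(μ_L - μ_K) can be
    -- eliminated in favour of the functions occurring in the RTT relations.
    have h1 : muRHom ℓ N (hfun ℓ L K) = muLHom ℓ N (hfun ℓ I J) + muLHom ℓ N (hfun ℓ J I) -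
        muRHom ℓ N (hfun ℓ K L) := by
      rw [eq_sub_iff_add_eq, ← RingHom.map_add, ← RingHom.map_add, hfun_add_hfun hq hKL.ne', hfun_add_hfun hq hIJ.ne,
        qMero, ← map_inv₀, ← RingHom.map_add, ← muR_eq_hom, ← muL_eq_hom, muR_const, muL_const]
    have h2 : muLHom ℓ N (hfun ℓ J I) * muLHom ℓ N (hfun ℓ I J) =
        muLHom ℓ N (hfun ℓ I J) * muLHom ℓ N (hfun ℓ J I) := by
      rw [← map_mul, ← map_mul, mul_comm]
    have h3 := muLHom_mul_muRHom (ℓ := ℓ) (hfun ℓ J I) (hfun ℓ K L)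
    rw [h1, tgen_cross hIJ hKL, tgen_diag hIJ hKL]
    generalize muLHom ℓ N (hfun ℓ I J) = a at *
    generalize muLHom ℓ N (hfun ℓ J I) = b at *
    generalize muRHom ℓ N (hfun ℓ K L) = m at *
    generalize tgen ℓ J K * tgen ℓ I L = Z
    generalize tgen ℓ J L * tgen ℓ I K = Y
    have h2' : b * (a * Z) = a * (b * Z) := by rw [← mul_assoc, h2, mul_assoc]
    have h3' : b * (m * Z) = m * (b * Z) := by rw [← mul_assoc, h3, mul_assoc]
    simp only [mul_add, add_mul, sub_mul, mul_sub, neg_mul, mul_neg, mul_assoc, h3']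
    abel

theorem genSign_eq_pairProd {r : ℕ} (σ : Equiv.Perm (Fin r)) (I : Fin r ↪o Fin N) :
    genSign ℓ σ I = pairProd (fun i j : Fin N => j < i) (hfun ℓ) (I ∘ σ) := by
  rw [genSign, Finset.prod_filter, Fintype.prod_prod_type, pairProd]
  simp only [Function.comp_apply, I.lt_iff_lt]

theorem pairProd_lt_mul_pairProd_gt {r : ℕ} {c : Fin r → Fin N} (hc : Function.Injective c) :
    pairProd (fun i j : Fin N => i < j) (hfun ℓ) c * pairProd (fun i j : Fin N => j < i) (hfun ℓ) c
      = ∏ k, ∏ l, if k < l then -hfun ℓ (c k) (c l) else 1 := by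
  simp only [pairProd, ← Finset.prod_mul_distrib]
  refine Finset.prod_congr rfl fun k _ => Finset.prod_congr rfl fun l _ => ?_
  by_cases hkl : k < l
  · rcases lt_or_gt_of_ne (hc.ne hkl.ne) with h | h <;> simp [hkl, h, h.not_gt]
  · simp [hkl]

/-- The minor does not depend on the auxiliary permutation, and equals a column
antisymmetrization. -/
theorem minor_eq_antisymm (hq : ∀ k : ℕ, 0 < k → Complex.exp ℓ ^ k ≠ 1) {r : ℕ}
    (ρ : Equiv.Perm (Fin r)) (I J : Fin r ↪o Fin N) :
    minor ℓ ρ I J = antisymm (fun i j : Fin N => i < j) (hfun ℓ) (muRHom ℓ N) (tgen ℓ) J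
      (I ∘ Fin.rev) := by
  have hq2 := hq 2 two_pos
  have hcol := exchangeSystem_col (N := N) hq2
  have hrow := exchangeSystem_row (N := N) hq2
  set D := antisymm (fun i j : Fin N => i < j) (hfun ℓ) (muRHom ℓ N) (tgen ℓ) J (I ∘ Fin.rev)
    with hDdef
  set A := antisymm (fun i j : Fin N => j < i) (hfun ℓ) (muLHom ℓ N) (fun i j => tgen ℓ j i) I J
    with hAdef
  have hA : ∀ ρ : Equiv.Perm (Fin r), ∑ σ : Equiv.Perm (Fin r),
      muLHom ℓ N (pairProd (fun i j : Fin N => j < i) (hfun ℓ) (I ∘ σ)) *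
        word (tgen ℓ) (I ∘ σ) (J ∘ ρ) =
      muRHom ℓ N (pairProd (fun i j : Fin N => j < i) (hfun ℓ) (J ∘ ρ)) * A := fun ρ =>
    hcol.antisymm_comp_perm I.injective J.injective
      (fun k l hkl => (J.lt_iff_lt.mpr hkl).not_gt) ρ
  have hD : ∀ σ : Equiv.Perm (Fin r),
      antisymm (fun i j : Fin N => i < j) (hfun ℓ) (muRHom ℓ N) (tgen ℓ) J (I ∘ σ) =
      muLHom ℓ N (pairProd (fun i j : Fin N => i < j) (hfun ℓ) (I ∘ σ)) * D := fun σ => by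
    have := hrow.antisymm_comp_perm (J := J) (a := I ∘ Fin.rev) J.injective
      (I.injective.comp Fin.rev_injective)
      (fun k l hkl => (I.lt_iff_lt.mpr (Fin.rev_lt_rev.mpr hkl)).not_gt) (Fin.revPerm * σ)
    -- The order of rows with empty `pairProd` is the decreasing one, so σ is measured from the
    -- reversal.
    have e : (I ∘ Fin.rev) ∘ ⇑(Fin.revPerm * σ : Equiv.Perm (Fin r)) = I ∘ σ := by
      funext k; simp
    rwa [e] at this
  have hminor : minor ℓ ρ I J = A := by
    have h1 : minor ℓ ρ I J = muRHom ℓ N (genSign ℓ ρ J)⁻¹ * ∑ σ : Equiv.Perm (Fin r),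
      muLHom ℓ N (pairProd (fun i j : Fin N => j < i) (hfun ℓ) (I ∘ σ)) *
        word (tgen ℓ) (I ∘ σ) (J ∘ ρ) := by
      simp only [← genSign_eq_pairProd]
      rfl
    rw [h1, hA, genSign_eq_pairProd, ← mul_assoc, ← map_mul, inv_mul_cancel₀, map_one, one_mul]
    exact pairProd_ne_zero hcol.h_ne_zero_of_lt _
  obtain ⟨c, hc, hsum⟩ := exists_sum_perm_prod_hfun hq r
  -- Both sides equal the double antisymmetrization over rows and columns. Summing over rows first
  -- leaves A, over columns first leaves D; the accumulated weights cover all pairs of positions and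
  -- sum to the constant c.
  have key : algebraMap ℂ (MatAlg ℓ N) c * A = algebraMap ℂ (MatAlg ℓ N) c * D := by
    calc algebraMap ℂ (MatAlg ℓ N) c * A
        = ∑ ρ : Equiv.Perm (Fin r),
          muRHom ℓ N (pairProd (fun i j : Fin N => i < j) (hfun ℓ) (J ∘ ρ)) *
          ∑ σ : Equiv.Perm (Fin r),
            muLHom ℓ N (pairProd (fun i j : Fin N => j < i) (hfun ℓ) (I ∘ σ)) *
              word (tgen ℓ) (I ∘ σ) (J ∘ ρ) := by
          rw [← muR_const, ← hsum N J J.injective, muR_eq_hom, map_sum, Finset.sum_mul]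
          refine Finset.sum_congr rfl fun ρ _ => ?_
          rw [hA, ← mul_assoc, ← map_mul, pairProd_lt_mul_pairProd_gt (J.injective.comp ρ.injective)]
          rfl
      _ = ∑ σ : Equiv.Perm (Fin r),
          muLHom ℓ N (pairProd (fun i j : Fin N => j < i) (hfun ℓ) (I ∘ σ)) *
          antisymm (fun i j : Fin N => i < j) (hfun ℓ) (muRHom ℓ N) (tgen ℓ) J (I ∘ σ) := by
          simp only [antisymm, Finset.mul_sum]
          rw [Finset.sum_comm]
          refine Finset.sum_congr rfl fun σ _ => Finset.sum_congr rfl fun ρ _ => ?_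
          rw [← mul_assoc, ← mul_assoc, muLHom_mul_muRHom]
      _ = algebraMap ℂ (MatAlg ℓ N) c * D := by
          rw [← muL_const, ← hsum N I I.injective, muL_eq_hom, map_sum, Finset.sum_mul]
          refine Finset.sum_congr rfl fun σ _ => ?_
          rw [hD, ← mul_assoc, ← map_mul, mul_comm,
            pairProd_lt_mul_pairProd_gt (I.injective.comp σ.injective)]
          rfl
  have key' := congrArg (algebraMap ℂ (MatAlg ℓ N) c⁻¹ * ·) key
  simp only [← mul_assoc, ← map_mul, inv_mul_cancel₀ hc, map_one, one_mul] at key'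
  rw [hminor, key']

theorem word_mul_muR_pairProd (hq : Complex.exp ℓ ^ 2 ≠ 1) {r s : ℕ} (a c : Fin r → Fin N)
    (d : Fin s → Fin N) (hcd : ∀ i j, c i ≠ d j) :
    word (tgen ℓ) a c * muRHom ℓ N (pairProd (fun i j : Fin N => i < j) (hfun ℓ) d) =
      muRHom ℓ N (pairProd (fun i j : Fin N => i < j) (hfun ℓ) d) * word (tgen ℓ) a c := by
  have S := exchangeSystem_row (N := N) hq
  have h := S.word_mul_pairProd a c d hcd
  exact h

theorem antisymm_id_eq_zero (hq : Complex.exp ℓ ^ 2 ≠ 1) {a : Fin N → Fin N}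
    (ha : ¬Function.Injective a) :
    antisymm (fun i j : Fin N => i < j) (hfun ℓ) (muRHom ℓ N) (tgen ℓ) id a = 0 := by
  have S := exchangeSystem_row (N := N) hq
  have h := S.antisymm_eq_zero (J := id) Function.injective_id ha
  exact h

/-- The determinant is the column antisymmetrization with all rows in decreasing order; another
order of the rows costs its `pairProd`. -/
theorem antisymm_id_perm (hq : ∀ k : ℕ, 0 < k → Complex.exp ℓ ^ k ≠ 1)
    (τ π : Equiv.Perm (Fin N)) :
    antisymm (fun i j : Fin N => i < j) (hfun ℓ) (muRHom ℓ N) (tgen ℓ) id π =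
      muL ℓ (pairProd (fun i j : Fin N => i < j) (hfun ℓ) π) * det ℓ τ := by
  have h3 := (exchangeSystem_row (N := N) (hq 2 two_pos)).antisymm_comp_perm (J := id)
    (a := Fin.rev) Function.injective_id Fin.rev_injective
    (fun k l hkl => (Fin.rev_lt_rev.mpr hkl).not_gt) (Fin.revPerm * π : Equiv.Perm (Fin N))
  have h4 : Fin.rev ∘ ⇑(Fin.revPerm * π : Equiv.Perm (Fin N)) = π := by
    funext x
    simp
  rw [h4] at h3
  rw [det, minor_eq_antisymm hq]
  exact h3

end minors

/-! ### Products over blocks -/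

section blocks

theorem prod_ofFn_sum {A X : Type*} [Semiring A] [Fintype X] :
    ∀ {n : ℕ} (F : Fin n → X → A), (List.ofFn fun k => ∑ x, F k x).prod =
      ∑ x : Fin n → X, (List.ofFn fun k => F k (x k)).prod := by
  intro n
  induction n with
  | zero => intro F; simp
  | succ n ih =>
    intro F
    rw [List.ofFn_succ, List.prod_cons, ih fun k => F k.succ, Finset.sum_mul_sum,
      ← Equiv.sum_comp (Fin.consEquiv fun _ : Fin (n + 1) => X), Fintype.sum_prod_type]
    refine Finset.sum_congr rfl fun x _ => Finset.sum_congr rfl fun y _ => ?_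
    rw [List.ofFn_succ, List.prod_cons]
    rfl

/-- Collects the scalars of all blocks in front; each only has to pass the blocks to its left. -/
theorem prod_ofFn_hom_mul {K A : Type*} [CommSemiring K] [Semiring A] (κ : K →+* A) :
    ∀ {n : ℕ} (f : Fin n → K) (W : Fin n → A),
      (∀ i k, i < k → W i * κ (f k) = κ (f k) * W i) →
      (List.ofFn fun k => κ (f k) * W k).prod = κ (∏ k, f k) * (List.ofFn W).prod := by
  intro n
  induction n with
  | zero => intro f W _; simp
  | succ n ih =>
    intro f W h
    have h1 : W 0 * κ (∏ k : Fin n, f k.succ) = κ (∏ k : Fin n, f k.succ) * W 0 := by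
      refine Finset.prod_induction _ (fun x => W 0 * κ x = κ x * W 0) ?_ (by simp)
        fun k _ => h 0 k.succ k.succ_pos
      intro x y hx hy
      rw [map_mul, ← mul_assoc, hx, mul_assoc, hy, mul_assoc]
    rw [List.ofFn_succ, List.prod_cons, ih _ _ fun i k hik => h _ _ (Fin.succ_lt_succ_iff.mpr hik),
      List.ofFn_succ, List.prod_cons, Fin.prod_univ_succ, map_mul, mul_assoc, ← mul_assoc (W 0), h1]
    simp only [mul_assoc]

theorem prod_ofFn_blocks {A : Type*} [Monoid A] {n m : ℕ} (f : Fin (n * m) → A) :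
    (List.ofFn f).prod =
      (List.ofFn fun k : Fin n => (List.ofFn fun a : Fin m => f (finProdFinEquiv (k, a))).prod).prod
      := by
  rw [List.ofFn_mul, List.prod_flatten, List.map_ofFn]
  congr 2
  funext k
  simp only [Function.comp_apply]
  congr 2
  funext a
  congr 1
  ext
  simp [add_comm, mul_comm]

theorem finProdFinEquiv_lt_iff {n m : ℕ} {k l : Fin n} {a b : Fin m} :
    finProdFinEquiv (k, a) < finProdFinEquiv (l, b) ↔ k < l ∨ k = l ∧ a < b := by
  rw [Fin.lt_def, finProdFinEquiv_apply_val, finProdFinEquiv_apply_val, Fin.lt_def, Fin.lt_def,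
    Fin.ext_iff]
  have ha := a.2
  have hb := b.2
  dsimp only
  rcases lt_trichotomy k.1 l.1 with h | h | h
  · have := Nat.mul_le_mul_left m (Nat.succ_le_of_lt h)
    rw [Nat.mul_succ] at this
    exact iff_of_true (by omega) (Or.inl h)
  · rw [h]; simp
  · have := Nat.mul_le_mul_left m (Nat.succ_le_of_lt h)
    rw [Nat.mul_succ] at this
    exact iff_of_false (by omega) (by omega)

theorem prod_pairs_blocks {M : Type*} [CommMonoid M] {n m : ℕ}
    (ψ : Fin (n * m) → Fin (n * m) → M) :
    (∏ x, ∏ y, if x < y then ψ x y else 1) =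
      (∏ k : Fin n, ∏ a : Fin m, ∏ b : Fin m,
        if a < b then ψ (finProdFinEquiv (k, a)) (finProdFinEquiv (k, b)) else 1) *
      ∏ k : Fin n, ∏ l : Fin n, if k < l then ∏ a : Fin m, ∏ b : Fin m,
        ψ (finProdFinEquiv (k, a)) (finProdFinEquiv (l, b)) else 1 := by
  rw [← Equiv.prod_comp finProdFinEquiv, Fintype.prod_prod_type, ← Finset.prod_mul_distrib]
  refine Finset.prod_congr rfl fun k _ => ?_
  have h1 : ∀ a : Fin m, (∏ y, if finProdFinEquiv (k, a) < y then ψ (finProdFinEquiv (k, a)) y else 1)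
      = ∏ l : Fin n, ∏ b : Fin m, if finProdFinEquiv (k, a) < finProdFinEquiv (l, b) then
        ψ (finProdFinEquiv (k, a)) (finProdFinEquiv (l, b)) else 1 := fun a => by
    rw [← Equiv.prod_comp finProdFinEquiv, Fintype.prod_prod_type]
  have h2 : ∀ l : Fin n, (if k < l then ∏ a : Fin m, ∏ b : Fin m,
        ψ (finProdFinEquiv (k, a)) (finProdFinEquiv (l, b)) else 1) =
      ∏ a : Fin m, ∏ b : Fin m, if k < l then
        ψ (finProdFinEquiv (k, a)) (finProdFinEquiv (l, b)) else 1 := fun l => by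
    split_ifs <;> simp
  have h3 : ∀ a b : Fin m, (if a < b then
      ψ (finProdFinEquiv (k, a)) (finProdFinEquiv (k, b)) else 1) =
      ∏ l : Fin n, if k = l then (if a < b then
        ψ (finProdFinEquiv (k, a)) (finProdFinEquiv (l, b)) else 1) else 1 := fun a b => by
    rw [Finset.prod_ite_eq]; simp
  simp only [h1, h2, h3]
  rw [Finset.prod_comm (s := (Finset.univ : Finset (Fin n))), ← Finset.prod_mul_distrib]
  refine Finset.prod_congr rfl fun a _ => ?_
  rw [Finset.prod_comm (s := (Finset.univ : Finset (Fin m))), ← Finset.prod_mul_distrib]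
  refine Finset.prod_congr rfl fun l _ => ?_
  rw [← Finset.prod_mul_distrib]
  refine Finset.prod_congr rfl fun b _ => ?_
  rcases lt_trichotomy k l with h | h | h
  · simp [finProdFinEquiv_lt_iff, h, h.ne]
  · simp [finProdFinEquiv_lt_iff, h]
  · simp [finProdFinEquiv_lt_iff, h.not_gt, h.ne']

/-- The family `a_1, …, a_n` of sequences of length `m` as one sequence of length `nm`. -/
def concat {X : Type*} {n m : ℕ} (a : Fin n → Fin m → X) (x : Fin (n * m)) : X :=
  a (finProdFinEquiv.symm x).1 (finProdFinEquiv.symm x).2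

@[simp] theorem concat_apply {X : Type*} {n m : ℕ} (a : Fin n → Fin m → X) (k : Fin n)
    (i : Fin m) : concat a (finProdFinEquiv (k, i)) = a k i := by
  simp [concat]

variable {n m : ℕ}

/-- The permutation listing the blocks of `σ` in the opposite order, the `k`-th of them permuted
by `ρ k`. -/
def BlockPerm.arrange (σ : BlockPerm n m) (ρ : Fin n → Equiv.Perm (Fin m)) :
    Equiv.Perm (Fin (n * m)) :=
  finProdFinEquiv.permCongr (Equiv.prodShear Fin.revPerm ρ) |>.trans σ.1

theorem BlockPerm.coe_arrange (σ : BlockPerm n m) (ρ : Fin n → Equiv.Perm (Fin m)) :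
    ⇑(σ.arrange ρ) = concat fun k => σ.block k.rev ∘ ρ k := by
  funext x
  obtain ⟨⟨k, a⟩, rfl⟩ := finProdFinEquiv.surjective x
  rw [concat_apply]
  simp [arrange, block]

theorem concat_injective {X : Type*} : Function.Injective (concat : (Fin n → Fin m → X) → _) := by
  intro a b h
  funext k i
  rw [← concat_apply a, h, concat_apply]

theorem BlockPerm.ext_block {σ τ : BlockPerm n m} (h : ∀ k, σ.block k = τ.block k) : σ = τ := by
  refine Subtype.ext (Equiv.ext fun x => ?_)
  obtain ⟨⟨k, a⟩, rfl⟩ := finProdFinEquiv.surjective x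
  exact DFunLike.congr_fun (h k) a

theorem orderEmbedding_eq_of_comp_perm {α : Type*} [LinearOrder α] {I J : Fin m ↪o α}
    {ρ ρ' : Equiv.Perm (Fin m)} (h : I ∘ ρ = J ∘ ρ') : I = J := by
  refine DFunLike.coe_injective ((StrictMono.range_inj I.strictMono J.strictMono).mp ?_)
  rw [← EquivLike.range_comp I ρ, h, EquivLike.range_comp]

/-- A permutation of [1, nm] amounts to an ordered partition into n blocks of size m together with
an ordering of each block. Sorting the blocks recovers these data. -/
theorem BlockPerm.arrange_bijective :
    Function.Bijective fun x : BlockPerm n m × (Fin n → Equiv.Perm (Fin m)) => x.1.arrange x.2 := by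
  constructor
  · rintro ⟨σ, ρ⟩ ⟨τ, π⟩ h
    have h1 : ⇑(σ.arrange ρ) = ⇑(τ.arrange π) := congrArg _ h
    rw [coe_arrange, coe_arrange] at h1
    have h2 := fun k => congrFun (concat_injective h1) k
    have h3 : σ = τ := BlockPerm.ext_block fun k => by
      simpa using orderEmbedding_eq_of_comp_perm (h2 k.rev)
    subst h3
    refine Prod.ext rfl (funext fun k => Equiv.ext fun a => ?_)
    exact (σ.block k.rev).injective (congrFun (h2 k) a)
  · intro π
    let f : Fin n → Fin m → Fin (n * m) := fun k a => π (finProdFinEquiv (k.rev, a))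
    have hf : ∀ k, Function.Injective (f k) := fun k a b h => by
      simpa using finProdFinEquiv.injective (π.injective h)
    let s : Fin n → Equiv.Perm (Fin m) := fun k => Tuple.sort (f k)
    let σ : Equiv.Perm (Fin (n * m)) :=
      (finProdFinEquiv.permCongr (Equiv.prodShear Fin.revPerm s)).trans π
    have hσ : ∀ k a, σ (finProdFinEquiv (k, a)) = f k (s k a) := fun k a => by
      simp [σ, f]
    refine ⟨⟨⟨σ, fun k => ?_⟩, fun k => (s k.rev).symm⟩, ?_⟩
    · have h1 : (fun a => σ (finProdFinEquiv (k, a))) = f k ∘ s k := funext (hσ k)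
      rw [h1]
      exact (Tuple.monotone_sort (f k)).strictMono_of_injective ((hf k).comp (s k).injective)
    · refine Equiv.ext fun x => ?_
      obtain ⟨⟨k, a⟩, rfl⟩ := finProdFinEquiv.surjective x
      rw [coe_arrange, concat_apply]
      change σ (finProdFinEquiv (k.rev, _)) = _
      rw [hσ]
      simp [f]

end blocks

/-! ### Laplace expansion along blocks of columns -/

section laplace

variable {ℓ : ℂ} {n m : ℕ}

theorem pairProd_arrange (σ : BlockPerm n m) (ρ : Fin n → Equiv.Perm (Fin m)) :
    pairProd (fun i j : Fin (n * m) => i < j) (hfun ℓ) (σ.arrange ρ) =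
      genSignTilde ℓ σ.1 (RelEmbedding.refl _) *
        ∏ k, pairProd (fun i j : Fin (n * m) => i < j) (hfun ℓ) (σ.block k.rev ∘ ρ k) := by
  let φ : Fin (n * m) → Fin (n * m) → Mero (n * m) := fun x y => if x < y then -hfun ℓ x y else 1
  have h1 : ∀ {r : ℕ} (c : Fin r → Fin (n * m)),
      pairProd (fun i j : Fin (n * m) => i < j) (hfun ℓ) c =
        ∏ k, ∏ l, if k < l then φ (c k) (c l) else 1 := by
    intro r c
    refine Finset.prod_congr rfl fun k _ => Finset.prod_congr rfl fun l _ => ?_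
    rw [ite_and]
  have h2 : genSignTilde ℓ σ.1 (RelEmbedding.refl _) =
      ∏ x, ∏ y, if x < y then φ (σ.1 y) (σ.1 x) else 1 := by
    rw [genSignTilde, Finset.prod_filter, Fintype.prod_prod_type]
    refine Finset.prod_congr rfl fun k _ => Finset.prod_congr rfl fun l _ => ?_
    rw [ite_and]
    rfl
  have h3 : ∀ k a, σ.1 (finProdFinEquiv (k, a)) = σ.block k a := fun _ _ => rfl
  rw [h1, h2, prod_pairs_blocks, prod_pairs_blocks]
  refine (mul_comm _ _).trans ?_
  simp only [h1, σ.coe_arrange, concat_apply, h3]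
  congr 1
  -- Each block of σ is increasing, so only pairs from different blocks contribute to S̃(σ); these
  -- contributions do not see the order inside the blocks.
  have h4 : ∀ k : Fin n, (∏ a : Fin m, ∏ b : Fin m,
      if a < b then φ (σ.block k b) (σ.block k a) else 1) = 1 := by
    refine fun k => Finset.prod_eq_one fun a _ => Finset.prod_eq_one fun b _ => ?_
    split_ifs with hab
    · exact if_neg ((σ.block k).lt_iff_lt.mpr hab).not_gt
    · rfl
  have h5 : ∀ k l : Fin n, (∏ a : Fin m, ∏ b : Fin m,
      φ ((σ.block k.rev ∘ ρ k) a) ((σ.block l.rev ∘ ρ l) b)) =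
      ∏ a : Fin m, ∏ b : Fin m, φ (σ.block k.rev a) (σ.block l.rev b) := by
    intro k l
    exact (Equiv.prod_comp (ρ k) fun a => ∏ b, φ (σ.block k.rev a) (σ.block l.rev (ρ l b))).trans
      (Finset.prod_congr rfl fun a _ =>
        Equiv.prod_comp (ρ l) fun b => φ (σ.block k.rev a) (σ.block l.rev b))
  simp only [h4, h5, Finset.prod_const_one, one_mul]
  -- Reversing the blocks turns an inversion of σ into a pair in increasing order, which explains
  -- the reversed arguments of h in S̃.
  rw [Finset.prod_comm, ← Equiv.prod_comp Fin.revPerm]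
  refine Finset.prod_congr rfl fun k _ => ?_
  rw [← Equiv.prod_comp Fin.revPerm]
  refine Finset.prod_congr rfl fun l _ => ?_
  simp only [Fin.revPerm_apply, Fin.rev_rev, Fin.rev_lt_rev]
  rw [Finset.prod_comm]

/-- Laplace expansion of a column antisymmetrization along blocks of columns. -/
theorem sum_blockPerm_antisymm (hq : Complex.exp ℓ ^ 2 ≠ 1) (a : Fin n → Fin m → Fin (n * m)) :
    ∑ σ : BlockPerm n m, muRHom ℓ (n * m) (genSignTilde ℓ σ.1 (RelEmbedding.refl _)) *
      (List.ofFn fun k : Fin n => antisymm (fun i j : Fin (n * m) => i < j) (hfun ℓ)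
        (muRHom ℓ (n * m)) (tgen ℓ) (σ.block k.rev) (a k)).prod =
    antisymm (fun i j : Fin (n * m) => i < j) (hfun ℓ) (muRHom ℓ (n * m)) (tgen ℓ) id
      (concat a) := by
  rw [antisymm, ← BlockPerm.arrange_bijective.sum_comp, Fintype.sum_prod_type]
  refine Finset.sum_congr rfl fun σ _ => ?_
  simp only [antisymm]
  rw [prod_ofFn_sum, Finset.mul_sum]
  refine Finset.sum_congr rfl fun ρ _ => ?_
  rw [prod_ofFn_hom_mul, ← mul_assoc, ← map_mul, ← pairProd_arrange, Function.id_comp]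
  · congr 1
    rw [word, prod_ofFn_blocks]
    simp only [σ.coe_arrange, concat_apply]
    rfl
  · intro k l hkl
    -- Different blocks of σ have disjoint columns, so their weights commute with each other's
    -- words.
    refine word_mul_muR_pairProd hq _ _ _ fun i j h => ?_
    have h1 := finProdFinEquiv.injective (σ.1.injective h)
    simp only [Prod.mk.injEq, Fin.rev_inj] at h1
    exact hkl.ne h1.1

theorem sum_blockPerm_minor (hq : ∀ k : ℕ, 0 < k → Complex.exp ℓ ^ k ≠ 1)
    (ρ : (Fin m ↪o Fin (n * m)) → (Fin m ↪o Fin (n * m)) → Equiv.Perm (Fin m))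
    (J : Fin n → (Fin m ↪o Fin (n * m))) :
    ∑ σ : BlockPerm n m, muRHom ℓ (n * m) (genSignTilde ℓ σ.1 (RelEmbedding.refl _)) *
      (List.ofFn fun k : Fin n =>
        minor ℓ (ρ (J k) (σ.block k.rev)) (J k) (σ.block k.rev)).prod =
    antisymm (fun i j : Fin (n * m) => i < j) (hfun ℓ) (muRHom ℓ (n * m)) (tgen ℓ) id
      (concat fun k => J k ∘ Fin.rev) := by
  rw [← sum_blockPerm_antisymm (hq 2 two_pos)]
  simp only [minor_eq_antisymm hq]

/-- If the concatenated rows were distinct they would form a permutation of [1, nm], and J would be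
the list of blocks of some block permutation. Hence a row is repeated and the antisymmetrization
vanishes. -/
theorem sum_blockPerm_minor_eq_zero (hq : ∀ k : ℕ, 0 < k → Complex.exp ℓ ^ k ≠ 1)
    (ρ : (Fin m ↪o Fin (n * m)) → (Fin m ↪o Fin (n * m)) → Equiv.Perm (Fin m))
    (J : Fin n → (Fin m ↪o Fin (n * m)))
    (hJ : ∀ τ : BlockPerm n m, (fun k : Fin n => τ.block k.rev) ≠ J) :
    ∑ σ : BlockPerm n m, muRHom ℓ (n * m) (genSignTilde ℓ σ.1 (RelEmbedding.refl _)) *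
      (List.ofFn fun k : Fin n =>
        minor ℓ (ρ (J k) (σ.block k.rev)) (J k) (σ.block k.rev)).prod = 0 := by
  rw [sum_blockPerm_minor hq]
  refine antisymm_id_eq_zero (hq 2 two_pos) fun hinj => ?_
  obtain ⟨⟨τ, π⟩, h⟩ := BlockPerm.arrange_bijective.2
    (Equiv.ofBijective _ (Finite.injective_iff_bijective.mp hinj))
  have h1 : (concat fun k => τ.block k.rev ∘ π k) = concat fun k => J k ∘ Fin.rev :=
    (τ.coe_arrange π).symm.trans (congrArg DFunLike.coe h)
  refine hJ τ (funext fun k => ?_)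
  exact orderEmbedding_eq_of_comp_perm (ρ := π k) (ρ' := Fin.revPerm)
    (congrFun (concat_injective h1) k)

/-- The rows form a permutation whose blocks are internally decreasing, so sorting them costs only
the contribution between blocks, which is S̃(π). -/
theorem sum_blockPerm_minor_block (hq : ∀ k : ℕ, 0 < k → Complex.exp ℓ ^ k ≠ 1)
    (ρ : (Fin m ↪o Fin (n * m)) → (Fin m ↪o Fin (n * m)) → Equiv.Perm (Fin m))
    (τ : Equiv.Perm (Fin (n * m))) (π : BlockPerm n m) :
    ∑ σ : BlockPerm n m, muRHom ℓ (n * m) (genSignTilde ℓ σ.1 (RelEmbedding.refl _)) *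
      (List.ofFn fun k : Fin n => minor ℓ (ρ (π.block k.rev) (σ.block k.rev)) (π.block k.rev)
        (σ.block k.rev)).prod =
    muL ℓ (genSignTilde ℓ π.1 (RelEmbedding.refl _)) * det ℓ τ := by
  rw [sum_blockPerm_minor hq ρ fun k => π.block k.rev]
  have h1 : (concat fun k => π.block k.rev ∘ Fin.rev) = ⇑(π.arrange fun _ => Fin.revPerm) :=
    (π.coe_arrange fun _ => Fin.revPerm).symm
  have h2 : pairProd (fun i j : Fin (n * m) => i < j) (hfun ℓ)
      (π.arrange fun _ => Fin.revPerm) = genSignTilde ℓ π.1 (RelEmbedding.refl _) := by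
    rw [pairProd_arrange, Finset.prod_eq_one, mul_one]
    exact fun k _ => pairProd_eq_one fun i j hij =>
      ((π.block k.rev).lt_iff_lt.mpr (Fin.rev_lt_rev.mpr hij)).not_gt
  rw [h1, antisymm_id_perm hq τ, h2]

end laplace

/-! ### Products in the tensor product algebra -/

section tensor

variable {ℓ : ℂ} {n m : ℕ}

theorem prod_ofFn_tmul {A B : Type*} [Ring A] [Algebra ℂ A] [Ring B] [Algebra ℂ B] :
    ∀ {n : ℕ} (a : Fin n → A) (b : Fin n → B),
      (List.ofFn fun k => a k ⊗ₜ[ℂ] b k).prod = (List.ofFn a).prod ⊗ₜ[ℂ] (List.ofFn b).prod := by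
  intro n
  induction n with
  | zero => intro a b; simp [Algebra.TensorProduct.one_def]
  | succ n ih =>
    intro a b
    rw [List.ofFn_succ, List.prod_cons, ih, Algebra.TensorProduct.tmul_mul_tmul, List.ofFn_succ,
      List.prod_cons, List.ofFn_succ, List.prod_cons]

theorem map_hyperPfTilde {A B : Type} [Ring A] [Ring B] (Φ : A →+* B) (act : Mero (n * m) → A)
    (X : (Fin m ↪o Fin (n * m)) → A) :
    Φ (hyperPfTilde ℓ act X) = hyperPfTilde ℓ (fun f => Φ (act f)) fun I => Φ (X I) := by
  simp only [hyperPfTilde, map_sum, map_mul, map_list_prod, List.map_ofFn]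
  rfl

theorem prod_bgen_mem (σ : BlockPerm n m) :
    (List.ofFn fun k : Fin n => bgen (σ.block k.rev)).prod ∈
      pfWt m (wtSet (RelEmbedding.refl _ : Fin (n * m) ↪o Fin (n * m))) := by
  have h1 := wordSpan_prod (g := PfAlg.gen) (deg := PfGen.deg)
    (fun k : Fin n => bgen (σ.block k.rev)) (fun k => wtSet (σ.block k.rev))
    (fun k => bgen_mem _)
  have e1 : ∑ k : Fin n, wtSet (σ.block k.rev) = ∑ k : Fin n, wtSet (σ.block k) :=
    Equiv.sum_comp Fin.revPerm (fun k => wtSet (σ.block k))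
  have e2 : ∑ k : Fin n, wtSet (σ.block k) = ∑ p : Fin (n * m), wt (σ.1 p) := by
    rw [← Equiv.sum_comp finProdFinEquiv, Fintype.sum_prod_type]
    rfl
  rw [e1, e2, Equiv.sum_comp σ.1 (fun p => wt p)] at h1
  exact h1

theorem scal_mul_mem {N : ℕ} {α : Fin N → ℂ} (f : Mero N) {b : PfAlg N m} (hb : b ∈ pfWt m α) :
    scal f * b ∈ pfWt m α := by
  have h := wordSpan_mul (wordSpan_gen (g := PfAlg.gen) (deg := PfGen.deg)
    (PfGen.scal (m := m) f)) hb
  have h0 : PfGen.deg (PfGen.scal (m := m) f) + α = α := zero_add α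
  rwa [h0] at h

theorem muL_mul_mem {N : ℕ} {α β : Fin N → ℂ} (f : Mero N) {t : MatAlg ℓ N}
    (ht : t ∈ matWt ℓ α β) : muL ℓ f * t ∈ matWt ℓ α β := by
  have h := wordSpan_mul (wordSpan_gen (g := MatAlg.gen ℓ) (deg := MatGen.deg)
    (MatGen.lam f)) ht
  have h0 : MatGen.deg (MatGen.lam f) + (α, β) = (α, β) := zero_add _
  rwa [h0] at h

theorem tmul_mem_preTensor {N : ℕ} {α β : Fin N → ℂ} {b : PfAlg N m} {t : MatAlg ℓ N}
    (hb : b ∈ pfWt m α) (ht : t ∈ matWt ℓ α β) : b ⊗ₜ[ℂ] t ∈ preTensor ℓ N m :=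
  Submodule.subset_span ⟨α, β, b, hb, t, ht, rfl⟩

/-- The element `1 ⊗ μ_r(f)` of `⊕ B̃_α ⊗ F_{αβ}`. -/
def preAct (ℓ : ℂ) {N : ℕ} (m : ℕ) (f : Mero N) : preTensor ℓ N m :=
  ⟨1 ⊗ₜ muR ℓ f, tmul_mem_preTensor (one_mem_pfWt N m) (muR_mem ℓ f)⟩

/-- The element `∑_J b̃_J ⊗ ξ^J_I` of `⊕ B̃_α ⊗ F_{αβ}`. -/
def preElt (ℓ : ℂ) {N m : ℕ}
    (ρ : (Fin m ↪o Fin N) → (Fin m ↪o Fin N) → Equiv.Perm (Fin m)) (I : Fin m ↪o Fin N) :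
    preTensor ℓ N m :=
  ∑ J : Fin m ↪o Fin N,
    ⟨bgen J ⊗ₜ minor ℓ (ρ J I) J I, tmul_mem_preTensor (bgen_mem J) (minor_mem ℓ (ρ J I) J I)⟩

/-- The expansion takes place in the ordinary tensor product over ℂ, where 1 ⊗ μ_r(f) acts on the
second factor alone and no moment map relation is needed. -/
theorem coe_hyperPfTilde_preElt
    (ρ : (Fin m ↪o Fin (n * m)) → (Fin m ↪o Fin (n * m)) → Equiv.Perm (Fin m)) :
    ((hyperPfTilde ℓ (preAct ℓ m) (preElt ℓ ρ) : preTensor ℓ (n * m) m) :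
        PfAlg (n * m) m ⊗[ℂ] MatAlg ℓ (n * m)) =
      ∑ J : Fin n → (Fin m ↪o Fin (n * m)), (List.ofFn fun k => bgen (J k)).prod ⊗ₜ[ℂ]
        ∑ σ : BlockPerm n m, muRHom ℓ (n * m) (genSignTilde ℓ σ.1 (RelEmbedding.refl _)) *
          (List.ofFn fun k : Fin n =>
            minor ℓ (ρ (J k) (σ.block k.rev)) (J k) (σ.block k.rev)).prod := by
  have h1 := map_hyperPfTilde (ℓ := ℓ) (preTensor ℓ (n * m) m).val.toRingHom (preAct ℓ m)
    (preElt ℓ ρ)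
  refine h1.trans ?_
  have h2 : ∀ I : Fin m ↪o Fin (n * m), (preTensor ℓ (n * m) m).val.toRingHom (preElt ℓ ρ I) =
      ∑ J, bgen J ⊗ₜ[ℂ] minor ℓ (ρ J I) J I := fun I => by
    rw [preElt, map_sum]
    rfl
  simp only [hyperPfTilde, h2, prod_ofFn_sum, prod_ofFn_tmul, TensorProduct.tmul_sum,
    Finset.mul_sum]
  rw [Finset.sum_comm]
  refine Finset.sum_congr rfl fun J _ => Finset.sum_congr rfl fun σ _ => ?_
  have h3 : (preTensor ℓ (n * m) m).val.toRingHom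
      (preAct ℓ m (genSignTilde ℓ σ.1 (RelEmbedding.refl _))) =
      1 ⊗ₜ[ℂ] muRHom ℓ (n * m) (genSignTilde ℓ σ.1 (RelEmbedding.refl _)) := rfl
  rw [h3, Algebra.TensorProduct.tmul_mul_tmul, one_mul]

/-- The minor summation formula for hyper-Pfaffians. -/
theorem hyperPfTilde_cElt (ℓ : ℂ) (hq : ∀ k : ℕ, 0 < k → Complex.exp ℓ ^ k ≠ 1) (m n : ℕ)
    (ρ : (Fin m ↪o Fin (n * m)) → (Fin m ↪o Fin (n * m)) → Equiv.Perm (Fin m))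
    (τ : Equiv.Perm (Fin (n * m))) :
    hyperPfTilde ℓ (dynAct ℓ m) (cElt ℓ ρ) =
      dynTmul ℓ ⟨pfB ℓ n m, pfB_mem ℓ n m⟩ ⟨det ℓ τ, minor_mem ℓ τ _ _⟩ := by
  -- The summands x and y have S̃(π) on the right and on the left of the tensor sign, respectively.
  let x : BlockPerm n m → preTensor ℓ (n * m) m := fun π =>
    ⟨_, tmul_mem_preTensor (prod_bgen_mem π)
      (muL_mul_mem (genSignTilde ℓ π.1 (RelEmbedding.refl _)) (minor_mem ℓ τ
        (RelEmbedding.refl _) (RelEmbedding.refl _)))⟩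
  let y : BlockPerm n m → preTensor ℓ (n * m) m := fun π =>
    ⟨_, tmul_mem_preTensor
      (scal_mul_mem (genSignTilde ℓ π.1 (RelEmbedding.refl _)) (prod_bgen_mem π))
      (minor_mem ℓ τ (RelEmbedding.refl _) (RelEmbedding.refl _))⟩
  have hC : hyperPfTilde ℓ (dynAct ℓ m) (cElt ℓ ρ) =
      RingQuot.mkRingHom (tensorRel ℓ (n * m) m) (hyperPfTilde ℓ (preAct ℓ m) (preElt ℓ ρ)) := by
    refine Eq.trans ?_ (map_hyperPfTilde (RingQuot.mkRingHom _) _ _).symm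
    congr 1
    funext I
    rw [preElt, map_sum]
    rfl
  have hx : hyperPfTilde ℓ (preAct ℓ m) (preElt ℓ ρ) = ∑ π, x π := by
    refine Subtype.ext ?_
    rw [coe_hyperPfTilde_preElt, AddSubmonoidClass.coe_finsetSum]
    symm
    -- Only the tuples J that come from a block permutation survive.
    refine Fintype.sum_of_injective (fun (π : BlockPerm n m) (k : Fin n) => π.block k.rev)
      (fun π π' h => BlockPerm.ext_block fun k => by simpa using congrFun h k.rev) _ _ ?_ ?_
    · intro J hJ
      rw [sum_blockPerm_minor_eq_zero hq ρ J fun π h => hJ ⟨π, h⟩, TensorProduct.tmul_zero]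
    · intro π
      rw [sum_blockPerm_minor_block hq ρ τ π]
      rfl
  have hy : RingQuot.mkRingHom (tensorRel ℓ (n * m) m) (∑ π, y π) = dynTmul ℓ
      ⟨pfB ℓ n m, pfB_mem ℓ n m⟩ ⟨det ℓ τ, minor_mem ℓ τ _ _⟩ := by
    refine congrArg _ (Subtype.ext ?_)
    rw [AddSubmonoidClass.coe_finsetSum]
    simp only [pfB, hyperPfTilde]
    rw [TensorProduct.sum_tmul]
    rfl
  rw [hC, hx, ← hy, map_sum, map_sum]
  -- The relation f b ⊗ t = b ⊗ μ_l(f) t is used here, with f = S̃(π), and nowhere else.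
  refine Finset.sum_congr rfl fun π _ => (RingQuot.mkRingHom_rel ?_).symm
  exact ⟨_, _, _, _, prod_bgen_mem π, _, minor_mem ℓ τ _ _, rfl, rfl⟩

end tensor

end DynPfaffian

end

theorem mainTheorem4 (ℓ : ℂ) (hq : ∀ k : ℕ, 0 < k → Complex.exp ℓ ^ k ≠ 1) (m n : ℕ)
    (ρ : (Fin m ↪o Fin (n * m)) → (Fin m ↪o Fin (n * m)) → Equiv.Perm (Fin m))
    (τ : Equiv.Perm (Fin (n * m))) :
    DynPfaffian.hyperPfTilde ℓ (DynPfaffian.dynAct ℓ m) (DynPfaffian.cElt ℓ ρ) =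
      DynPfaffian.dynTmul ℓ
        ⟨DynPfaffian.pfB ℓ n m, DynPfaffian.pfB_mem ℓ n m⟩
        ⟨DynPfaffian.det ℓ τ, DynPfaffian.minor_mem ℓ τ _ _⟩ := by
  exact DynPfaffian.hyperPfTilde_cElt ℓ hq m n ρ τ
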